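/- **Fourier integral operators.** Let $\Lambda\subset\mathbb R$, $\Theta\subset\mathbb R^{m-1}$, $\Omega'\subset\mathbb R^{n}$ be open. An operator $T$ from functions on $\Omega'$ to distributions on $\Lambda\times\Theta$ is a Fourier integral operator of order $k$, $T\in I^{k}(\Lambda\times\Theta,\Omega')$, with level-set function $\varphi$, if * $\Phi(p,\theta,z,\sigma)=\sigma\,(p-\varphi(z,\theta))$ is a phase function on $\Lambda\times\Theta\times\Omega'\times(\mathbb R\setminus\{0\})$: it is $C^\infty$, positively homogeneous of degree $1$ in $\sigma$, the pairs $(\partial_{p,\theta}\Phi,\partial_\sigma\Phi)$ and $(\partial_z\Phi,\partial_\sigma\Phi)$ vanish nowhere, and $\partial_{p,\theta,z}(\partial_\sigma\Phi)\ne0$ wherever $\partial_\sigma\Phi=0$; * there is an amplitude $a\in C^\infty(\Lambda\times\Theta\times\Omega'\times\mathbb R)$ of order $r$, with $k=r-\frac{n+m-2}{4}$, i.e. on every compact $K\subset\Lambda\times\Theta\times\Omega'$ every derivative of $a$, of order $j$ in $(p,\theta,z)$ and $\varrho$ in $\sigma$, is $O((1+|\sigma|)^{r-\varrho})$ uniformly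 for $\sigma\in\mathbb R$, such that $$T u(p,\theta)=\int\!\!\int e^{i\Phi(p,\theta,z,\sigma)}\,a(p,\theta,z,\sigma)\,u(z)\,dz\,d\sigma$$ in the sense of distributions on $\Lambda\times\Theta$ for all integrable $u$ with compact support in $\Omega'$; here the right-hand side is tested against $v\in C_c^\infty(\Lambda\times\Theta)$ before integrating in $\sigma$, and the resulting integral in $\sigma$ converges absolutely. **Second-order scattering.** Let $E_0,mc^2,r_e>0$ and let $n_e,\lambda_{PE}\in C^\infty(\mathbb R^3)$ (for instance, $C_c^\infty(\Omega)$ functions extended by $0$). Put $\mu_E=E^{-3}\lambda_{PE}+\sigma(E)\,n_e$, with $\sigma(E)$ the Klein–Nishina total cross-section, and $$A_E(\mathbf m,\mathbf n)=\|\mathbf n-\mathbf m\|^{-2}\exp\Bigl(-\|\mathbf n-\mathbf m\|\int_0^1\mu_E(\mathbf m+t(\mathbf n-\mathbf m))\,dt\Bigr).$$ Put $\psi(\mathbf y,\mathbf x,\mathbf s)=\frac{\mathbf y-\mathbf x}{\|\mathbf y-\mathbf x\|}\cdot\frac{\mathbf x-\mathbf s}{\|\mathbf x-\mathbf s\|}$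 and $$\Psi(\mathbf y,\mathbf x,\mathbf d,\mathbf s)=\psi(\mathbf y,\mathbf x,\mathbf s)+\cos\bigl(\cot^{-1}\phi(\mathbf y,\mathbf d,\mathbf x)\bigr),\qquad \phi(\mathbf y,\mathbf d,\mathbf x)=\frac{\kappa-\rho}{\sqrt{1-\kappa^2}},$$ $$\kappa=\frac{\mathbf y-\mathbf x}{\|\mathbf y-\mathbf x\|}\cdot\frac{\mathbf d-\mathbf x}{\|\mathbf d-\mathbf x\|},\qquad \rho=\frac{\|\mathbf y-\mathbf x\|}{\|\mathbf d-\mathbf x\|},$$ where $\cot^{-1}$ has values in $(0,\pi)$ and, if $\kappa^2=1$, $\cos(\cot^{-1}\phi)$ is given its value by continuity, $\operatorname{sign}(\kappa-\rho)$. So $\Psi=\cos\omega_1+\cos\omega_2$ is the sum of the cosines of the scattering angles at $\mathbf x$ and $\mathbf y$ along $\mathbf s\to\mathbf x\to\mathbf y\to\mathbf d$. Let $\mathcal W_2(n_e)=\|\nabla_{\mathbf x,\mathbf y}\Psi\|\,A_{E_0}(\mathbf s,\mathbf x)\,A_{E_{\omega_1}}(\mathbf x,\mathbf y)\,A_{E_{\omega_2}}(\mathbf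 y,\mathbf d)$, where $E_{\omega_1}$ and $E_{\omega_2}$ are the photon energies after the first and the second scattering, each given by the Compton formula $E\mapsto E/(1+\frac{E}{mc^2}(1-\cos\omega))$, starting from $E_0$. **Theorem 3.5.** Let $\Omega\subset\mathbb R^3$ be open, let the source $\mathbf s\notin\Omega$ be fixed, and let $\mathbf d:\Theta\to\mathbb R^3\setminus\Omega$, with $\Theta\subset\mathbb R^2$ open, be a $C^\infty$ parametrisation of the detector set $\mathbb D$ (functions and distributions on $\mathbb D$ are read in the parameter $\theta\in\Theta$). For each $\mathbf x\in\Omega$ let $\mathfrak N(\mathbf x)$ be a neighbourhood of $\mathbf x$, such that $$\Omega_2=\{(\mathbf x,\mathbf y)\in\Omega\times\Omega \mid \mathbf y\notin\mathfrak N(\mathbf x)\}$$ is open in $\mathbb R^6$. Let $\mathcal L_2$ be the operator $$\mathcal L_2(\bar f,n_e)(\lambda,\mathbf d,\mathbf s)=\int_\Omega\int_{\Omega\setminus\{\mathbf x\}}\mathcal W_2(n_e)(\mathbf x,\mathbf y,\mathbf d,\mathbf s)\,\bar f(\mathbf x,\mathbf y)\,\delta(\lambda-\Psi(\mathbf y,\mathbf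 x,\mathbf d,\mathbf s))\,d\mathbf y\,d\mathbf x,\qquad\lambda\in(0,2),$$ linear in the function $\bar f$ of six variables which stands for $f(\mathbf x)f(\mathbf y)$; that is, $$\langle\mathcal L_2(\bar f,n_e),v\rangle=\int_\Theta\int_\Omega\int_{\Omega\setminus\{\mathbf x\}}\mathcal W_2(n_e)(\mathbf x,\mathbf y,\mathbf d(\theta),\mathbf s)\,\bar f(\mathbf x,\mathbf y)\,v(\Psi(\mathbf y,\mathbf x,\mathbf d(\theta),\mathbf s),\theta)\,d\mathbf y\,d\mathbf x\,d\theta$$ for $v\in C_c^\infty((0,2)\times\Theta)$. Then, for $\bar f$ integrable with compact support in $\Omega_2$, this pairing converges absolutely, and $\mathcal L_2$ is a Fourier integral operator of order $-\frac74$ with level-set function $\Psi$, i.e. with phase $\sigma(\lambda-\Psi(\mathbf y,\mathbf x,\mathbf d,\mathbf s))$. In particular $$\mathcal L_2\in I^{-7/4}\bigl((0,2)\times\mathbb D,\Omega_2\bigr).$$ -/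

import Mathlib

open Set MeasureTheory Topology
open scoped ContDiff

noncomputable section

/-! ### Fourier integral operators with phase `σ (p - φ(x, θ))` -/

section FourierIntegral

variable {P X : Type*} [NormedAddCommGroup P] [NormedSpace ℝ P]
  [NormedAddCommGroup X] [NormedSpace ℝ X]

/-- Phase functions `Φ(p, θ, x, σ)` on `Λ × Θ × Ω × (ℝ ∖ {0})`: smooth, positively homogeneous of
degree one in `σ`, with `(∂_{p,θ} Φ, ∂_σ Φ)` and `(∂_x Φ, ∂_σ Φ)` nowhere zero, and nondegenerate,
i.e. `∂_{p,θ,x} (∂_σ Φ) ≠ 0` wherever `∂_σ Φ = 0`. -/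
structure IsPhaseFunction (Λ : Set ℝ) (Θ : Set P) (Ω : Set X)
    (Φ : ℝ → P → X → ℝ → ℝ) : Prop where
  smooth : ContDiffOn ℝ ∞ (fun q : ℝ × P × X × ℝ => Φ q.1 q.2.1 q.2.2.1 q.2.2.2)
    (Λ ×ˢ Θ ×ˢ Ω ×ˢ {0}ᶜ)
  homogeneous : ∀ p ∈ Λ, ∀ θ ∈ Θ, ∀ x ∈ Ω, ∀ σ : ℝ, σ ≠ 0 → ∀ r : ℝ, 0 < r →
    Φ p θ x (r * σ) = r * Φ p θ x σ
  data_ne_zero : ∀ p ∈ Λ, ∀ θ ∈ Θ, ∀ x ∈ Ω, ∀ σ : ℝ, σ ≠ 0 →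
    (fderiv ℝ (fun q : ℝ × P => Φ q.1 q.2 x σ) (p, θ), deriv (Φ p θ x) σ) ≠ 0
  object_ne_zero : ∀ p ∈ Λ, ∀ θ ∈ Θ, ∀ x ∈ Ω, ∀ σ : ℝ, σ ≠ 0 →
    (fderiv ℝ (fun x' : X => Φ p θ x' σ) x, deriv (Φ p θ x) σ) ≠ 0
  nondegenerate : ∀ p ∈ Λ, ∀ θ ∈ Θ, ∀ x ∈ Ω, ∀ σ : ℝ, σ ≠ 0 → deriv (Φ p θ x) σ = 0 →
    fderiv ℝ (fun q : ℝ × P × X => deriv (Φ q.1 q.2.1 q.2.2) σ) (p, θ, x) ≠ 0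

/-- Amplitudes of order `m` on `Λ × Θ × Ω × ℝ`: smooth functions such that on every compact
`K ⊆ Λ × Θ × Ω` all the derivatives of order `j` in `(p, θ, x)` and order `k` in `σ` are bounded by
`C (1 + |σ|) ^ (m - k)` for all `σ`. -/
structure IsAmplitude (m : ℝ) (Λ : Set ℝ) (Θ : Set P) (Ω : Set X)
    (a : ℝ → P → X → ℝ → ℂ) : Prop where
  smooth : ContDiffOn ℝ ∞ (fun q : ℝ × P × X × ℝ => a q.1 q.2.1 q.2.2.1 q.2.2.2)
    (Λ ×ˢ Θ ×ˢ Ω ×ˢ univ)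
  bound : ∀ K : Set (ℝ × P × X), IsCompact K → K ⊆ Λ ×ˢ Θ ×ˢ Ω → ∀ j k : ℕ,
    ∃ C : ℝ, ∀ q ∈ K, ∀ σ : ℝ,
      ‖iteratedFDeriv ℝ j
          (fun q' : ℝ × P × X => iteratedDeriv k (a q'.1 q'.2.1 q'.2.2) σ) q‖
        ≤ C * (1 + |σ|) ^ (m - (k : ℝ))

/-- Test functions on the open set `U`: smooth with compact support contained in `U`. -/
def IsTestFunction (U : Set X) (v : X → ℂ) : Prop :=
  ContDiff ℝ ∞ v ∧ HasCompactSupport v ∧ tsupport v ⊆ U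

variable [MeasureSpace P] [MeasureSpace X]

/-- The functions the operators are applied to: integrable, with compact support contained in `Ω`.
Every test function on `Ω` is one, and so is every product of an `L²` function with the indicator
of a compact subset of `Ω`. -/
def IsCompactlySupportedL1 (Ω : Set X) (u : X → ℂ) : Prop :=
  Integrable u ∧ HasCompactSupport u ∧ tsupport u ⊆ Ω

/-- The integrand of the oscillatory integral with phase `σ (p - φ(x, θ))` and amplitude `a`, acting
on `u` and tested against `v`. -/
def oscIntegrand (φ : X → P → ℝ) (a : ℝ → P → X → ℝ → ℂ) (u : X → ℂ) (v : ℝ × P → ℂ) (σ : ℝ)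
    (q : (ℝ × P) × X) : ℂ :=
  Complex.exp (Complex.I * ((σ * (q.1.1 - φ q.2 q.1.2) : ℝ) : ℂ)) * a q.1.1 q.1.2 q.2 σ
    * u q.2 * v q.1

/-- Operators from functions on `Ω` to distributions on `Λ × Θ` are given by their pairings
`T u v = ⟨T u, v⟩`. The operator `T` is a Fourier integral operator of order `k` with the level-set
function `φ` if `Φ = σ (p - φ(x, θ))` is a phase function and, in the sense of distributions,
`T u (p, θ) = ∫∫ exp (i Φ(p, θ, x, σ)) a(p, θ, x, σ) u(x) dx dσ`
for an amplitude `a` of order `m` with `k = m - (dim x + dim (p, θ) - 2) / 4`.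
The oscillatory integral is tested against `v(p, θ)` before the integration in `σ`,
and then converges absolutely. -/
def IsFIOWith (k : ℝ) (Λ : Set ℝ) (Θ : Set P) (Ω : Set X) (φ : X → P → ℝ)
    (T : (X → ℂ) → (ℝ × P → ℂ) → ℂ) : Prop :=
  IsOpen Λ ∧ IsOpen Θ ∧ IsOpen Ω ∧
  IsPhaseFunction Λ Θ Ω (fun p θ x σ => σ * (p - φ x θ)) ∧
  ∃ (m : ℝ) (a : ℝ → P → X → ℝ → ℂ),
    IsAmplitude m Λ Θ Ω a ∧
    k = m - ((Module.finrank ℝ X : ℝ) + (1 + (Module.finrank ℝ P : ℝ)) - 2) / 4 ∧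
    ∀ (u : X → ℂ) (v : ℝ × P → ℂ), IsCompactlySupportedL1 Ω u → IsTestFunction (Λ ×ˢ Θ) v →
      (∀ σ : ℝ, Integrable (oscIntegrand φ a u v σ)) ∧
      Integrable (fun σ : ℝ => ∫ q, oscIntegrand φ a u v σ q) ∧
      T u v = ∫ σ : ℝ, ∫ q, oscIntegrand φ a u v σ q

/-- The class `I^k(Λ × Θ, Ω)` of Fourier integral operators of order `k`. -/
def FIOClass (k : ℝ) (Λ : Set ℝ) (Θ : Set P) (Ω : Set X) :
    Set ((X → ℂ) → (ℝ × P → ℂ) → ℂ) :=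
  {T | ∃ φ : X → P → ℝ, IsFIOWith k Λ Θ Ω φ T}

end FourierIntegral

/-! ### Compton scattering -/

/-- Three-dimensional Euclidean space. -/
abbrev E3 := EuclideanSpace ℝ (Fin 3)

/-- The energy of the source, the energy `mc²` of an electron at rest, and the classical radius of
an electron. -/
structure PhysicalConstants where
  E₀ : ℝ
  mc2 : ℝ
  re : ℝ
  E₀_pos : 0 < E₀
  mc2_pos : 0 < mc2
  re_pos : 0 < re

/-- The Compton formula: the energy of a photon of energy `E` after a scattering with an angle whose
cosine is `c`. -/
def comptonEnergy (C : PhysicalConstants) (E c : ℝ) : ℝ :=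
  E / (1 + E / C.mc2 * (1 - c))

/-- The total cross-section `σ(E)` of the Compton effect (Klein–Nishina). -/
def crossSection (C : PhysicalConstants) (E : ℝ) : ℝ :=
  let k := E / C.mc2
  2 * Real.pi * C.re ^ 2 *
    ((1 + k) / k ^ 2 * (2 * (1 + k) / (1 + 2 * k) - Real.log (1 + 2 * k) / k)
      + Real.log (1 + 2 * k) / (2 * k) - (1 + 3 * k) / (1 + 2 * k) ^ 2)

/-- The lineic attenuation `μ_E = E⁻³ λ_PE + σ(E) n_e`. -/
def attenuation (C : PhysicalConstants) (lamPE nE : E3 → ℝ) (E : ℝ) (x : E3) : ℝ :=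
  (E ^ 3)⁻¹ * lamPE x + crossSection C E * nE x

/-- The factor `A_E(m, n)`: Beer–Lambert law and photometric dispersion. -/
def pathFactor (C : PhysicalConstants) (lamPE nE : E3 → ℝ) (E : ℝ) (m n : E3) : ℝ :=
  (‖n - m‖ ^ 2)⁻¹ *
    Real.exp (-(‖n - m‖ * ∫ t in (0 : ℝ)..1, attenuation C lamPE nE E (m + t • (n - m))))

/-- `κ(x, d, s)`, the cosine of the angle at `s` between `x` and `d`. -/
def kappa (x d s : E3) : ℝ := inner ℝ (‖x - s‖⁻¹ • (x - s)) (‖d - s‖⁻¹ • (d - s))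

/-- `ρ(x, d, s)`. -/
def rho (x d s : E3) : ℝ := ‖x - s‖ / ‖d - s‖

/-- The characteristic function `φ(x, d, s)` of the spindle torus, equal to `cot ω` where `ω` is the
scattering angle at `x` of a photon going from `s` to `x` to `d`. -/
def torusPhi (x d s : E3) : ℝ := (kappa x d s - rho x d s) / √(1 - kappa x d s ^ 2)

/-- `cot⁻¹ : ℝ → (0, π)`. -/
def arccot (t : ℝ) : ℝ := Real.pi / 2 - Real.arctan t

/-- `cos (cot⁻¹ φ(y, d, x))`, the cosine of the scattering angle at `y`. When `y` lies on the line
through `x` and `d` the denominator of `φ` vanishes and `φ = ±∞`; there the value is the one by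
continuity, `1` for forward scattering and `-1` for backward scattering. -/
def cosTorus (y d x : E3) : ℝ :=
  if kappa y d x ^ 2 = 1 then Real.sign (kappa y d x - rho y d x)
  else Real.cos (arccot (torusPhi y d x))

/-- The characteristic function `ψ(y, x, s)` of the cone. -/
def conePsi (y x s : E3) : ℝ := inner ℝ (‖y - x‖⁻¹ • (y - x)) (‖x - s‖⁻¹ • (x - s))

/-- `Ψ(y, x, d, s) = cos ω₁ + cos ω₂`. -/
def scatterPsi (y x d s : E3) : ℝ := conePsi y x s + cosTorus y d x

/-- The Euclidean norm of the gradient of `Ψ` with respect to `(x, y)`. -/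
def normGradPsi (x y d s : E3) : ℝ :=
  √(‖gradient (fun x' : E3 => scatterPsi y x' d s) x‖ ^ 2
    + ‖gradient (fun y' : E3 => scatterPsi y' x d s) y‖ ^ 2)

/-- The physical factors `w₂ = A_{E₀}(s, x) A_{E_ω₁}(x, y) A_{E_ω₂}(y, d)`, where `E_ω₁` and `E_ω₂`
are the energies after the first and the second scattering. -/
def weight2 (C : PhysicalConstants) (lamPE nE : E3 → ℝ) (x y d s : E3) : ℝ :=
  let E₁ := comptonEnergy C C.E₀ (conePsi y x s)
  let E₂ := comptonEnergy C E₁ (cosTorus y d x)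
  pathFactor C lamPE nE C.E₀ s x * pathFactor C lamPE nE E₁ x y * pathFactor C lamPE nE E₂ y d

/-- `𝒲₂(n_e) = ‖∇_{x,y} Ψ‖ w₂(n_e)`. -/
def scatterWeight (C : PhysicalConstants) (lamPE nE : E3 → ℝ) (x y d s : E3) : ℝ :=
  normGradPsi x y d s * weight2 C lamPE nE x y d s

/-- The set `Ω₂` of the pairs `(x, y)` in `Ω × Ω` with `y` outside the neighbourhood `N x`. -/
def Omega2 (Ω : Set E3) (N : E3 → Set E3) : Set (E3 × E3) :=
  {z | z.1 ∈ Ω ∧ z.2 ∈ Ω ∧ z.2 ∉ N z.1}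

/-- The integrand `𝒲₂(n_e)(x, y, d(θ), s) F(x, y) ∫ δ(λ - Ψ) v(λ, θ) dλ` of `⟨ℒ₂ F, v⟩`. -/
def scatterIntegrand (C : PhysicalConstants) (lamPE nE : E3 → ℝ) (s : E3)
    (d : EuclideanSpace ℝ (Fin 2) → E3) (F : E3 × E3 → ℂ)
    (v : ℝ × EuclideanSpace ℝ (Fin 2) → ℂ) (θ : EuclideanSpace ℝ (Fin 2)) (x y : E3) : ℂ :=
  (scatterWeight C lamPE nE x y (d θ) s : ℂ) * F (x, y) * v (scatterPsi y x (d θ) s, θ)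

/-- The second-order scattering operator
`ℒ₂(F, n_e)(λ, d, s) = ∫_Ω ∫_{Ω ∖ {x}} 𝒲₂(n_e)(x, y, d, s) F(x, y) δ(λ - Ψ(y, x, d, s)) dy dx`,
linear in the function `F(x, y)` of six variables which stands for `f(x) f(y)`. The detectors are
`d(θ)`, `θ ∈ Θ`, and `ℒ₂ F` is a distribution in `(λ, θ)`, given by its pairing with `v`,
where `∫ δ(λ - Ψ) v(λ, θ) dλ = v(Ψ, θ)`. -/
def scatterL2 (C : PhysicalConstants) (lamPE nE : E3 → ℝ) (s : E3) (Ω : Set E3)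
    (Θ : Set (EuclideanSpace ℝ (Fin 2))) (d : EuclideanSpace ℝ (Fin 2) → E3)
    (F : E3 × E3 → ℂ) (v : ℝ × EuclideanSpace ℝ (Fin 2) → ℂ) : ℂ :=
  ∫ θ in Θ, ∫ x in Ω, ∫ y in Ω \ {x}, scatterIntegrand C lamPE nE s d F v θ x y

end

/-! Formally `δ(λ - Ψ) = (2π)⁻¹ ∫ exp(iσ(λ - Ψ)) dσ`, so the operator has the amplitude `(2π)⁻¹ 𝒲₂`,
which does not depend on `σ` and has order `0`; with `6 + 3` variables this gives the order `0 -
7/4`. Three points need proof.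

Regularity of the level sets. `cosTorus y d x` is the cosine of the angle between `y - x` and `d -
y` (`cosTorus_eq_dirCos`). Moving `x` along `y - x` therefore changes only the first scattering
angle, and moving `y` only the second, at rates proportional to `1 - cos²`. At a critical point both
cosines are `±1`, so `Ψ` is `-2`, `0` or `2`, never in `(0, 2)`
(`scatterPsi_notMem_Ioo_of_critical`).

Smoothness of the amplitude. The factor `‖∇Ψ‖` is a square root, possibly singular at critical
points, which the phase space may contain. Only `λ = Ψ` matters in the pairing, so the amplitude is
multiplied by `levelCutoff λ Ψ`, which is one on the diagonal and vanishes near the points with `λ ∈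
(0, 2)` and `Ψ ∉ (0, 2)` (`contDiffAt_levelCutoff_mul`).

Meaning of the oscillatory integral. After testing, the `p`-integral is the Fourier transform of a
compactly supported smooth function, hence `O((1 + σ²)⁻¹)` uniformly in the other variables. Fubini
and Fourier inversion then evaluate the integral on the graph `p = Ψ` (`oscillatoryIntegral_eq`). -/

/-! ### Scattering angles as cosines between path segments -/

/-- The cosine of the angle between two vectors. -/
noncomputable def dirCos (u v : E3) : ℝ := inner ℝ (‖u‖⁻¹ • u) (‖v‖⁻¹ • v)

lemma dirCos_le_one (u v : E3) : dirCos u v ≤ 1 := by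
  have hn : ∀ w : E3, ‖‖w‖⁻¹ • w‖ ≤ 1 := fun w => by
    rw [norm_smul, norm_inv, norm_norm]
    exact inv_mul_le_one
  calc dirCos u v ≤ ‖‖u‖⁻¹ • u‖ * ‖‖v‖⁻¹ • v‖ := real_inner_le_norm _ _
    _ ≤ 1 * 1 := by gcongr <;> exact hn _
    _ = 1 := one_mul 1

lemma dirCos_eq_div (u v : E3) : dirCos u v = inner ℝ u v / (‖u‖ * ‖v‖) := by
  rw [dirCos, real_inner_smul_left, real_inner_smul_right]
  field_simp

lemma contDiffAt_normalize {E : Type*} [NormedAddCommGroup E] [NormedSpace ℝ E] {f : E → E3} {z : E}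
    (hf : ContDiffAt ℝ ∞ f z) (hf0 : f z ≠ 0) : ContDiffAt ℝ ∞ (fun z => ‖f z‖⁻¹ • f z) z :=
  ((hf.norm ℝ hf0).inv (norm_ne_zero_iff.2 hf0)).smul hf

lemma contDiffAt_dirCos {E : Type*} [NormedAddCommGroup E] [NormedSpace ℝ E] {f g : E → E3} {z : E}
    (hf : ContDiffAt ℝ ∞ f z) (hg : ContDiffAt ℝ ∞ g z) (hf0 : f z ≠ 0) (hg0 : g z ≠ 0) :
    ContDiffAt ℝ ∞ (fun z => dirCos (f z) (g z)) z :=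
  (contDiffAt_normalize hf hf0).inner ℝ (contDiffAt_normalize hg hg0)

lemma conePsi_eq_dirCos (y x s : E3) : conePsi y x s = dirCos (y - x) (x - s) := rfl

/-- `cos(π/2 - arctan t) = sin(arctan t) = t / √(1 + t²)`. -/
lemma cos_arccot_div_sqrt {m S : ℝ} (hS : 0 < S) :
    Real.cos (arccot (m / √S)) = m / √(S + m ^ 2) := by
  rw [arccot, Real.cos_pi_div_two_sub, Real.sin_arctan]
  have h1 : 1 + (m / √S) ^ 2 = (S + m ^ 2) / S := by
    rw [div_pow, Real.sq_sqrt hS.le]; field_simp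
  have h2 : 0 < √S := Real.sqrt_pos.2 hS
  have h3 : 0 < √(S + m ^ 2) := Real.sqrt_pos.2 (by positivity)
  rw [h1, Real.sqrt_div (by positivity)]
  field_simp

/-- Writing `d - y = (d - x) - (y - x)`, the inner product with `y - x` is `‖y - x‖ ‖d - x‖ (κ -
ρ)`, and the law of cosines gives `‖d - y‖² = ‖d - x‖² (1 - κ² + (κ - ρ)²)`. The quotient is the
cosine of `arccot φ`. On the line `κ² = 1` it degenerates to the sign of `κ - ρ`, where `d ≠ y`
excludes `κ = ρ`. -/
lemma cosTorus_eq_dirCos {y d x : E3} (hyx : y ≠ x) (hdx : d ≠ x) (hdy : d ≠ y) :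
    cosTorus y d x = dirCos (y - x) (d - y) := by
  have ha : 0 < ‖y - x‖ := norm_pos_iff.2 (sub_ne_zero.2 hyx)
  have hb : 0 < ‖d - x‖ := norm_pos_iff.2 (sub_ne_zero.2 hdx)
  have hc : 0 < ‖d - y‖ := norm_pos_iff.2 (sub_ne_zero.2 hdy)
  have hk : inner ℝ (y - x) (d - x) = kappa y d x * (‖y - x‖ * ‖d - x‖) := by
    have : kappa y d x = dirCos (y - x) (d - x) := rfl
    rw [this, dirCos_eq_div]; field_simp
  have hr : ‖y - x‖ = rho y d x * ‖d - x‖ := by rw [rho]; field_simp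
  set κ := kappa y d x
  set ρ := rho y d x
  have hdec : d - y = (d - x) - (y - x) := by abel
  have hin : inner ℝ (y - x) (d - y) = ‖y - x‖ * ‖d - x‖ * (κ - ρ) := by
    rw [hdec, inner_sub_right, hk, real_inner_self_eq_norm_sq]
    nth_rewrite 3 [hr]
    nth_rewrite 2 [hr]
    rw [hr]; ring
  have hcs : ‖d - y‖ ^ 2 = ‖d - x‖ ^ 2 * ((1 - κ ^ 2) + (κ - ρ) ^ 2) := by
    rw [hdec, norm_sub_sq_real, real_inner_comm, hk, hr]; ring
  have hpos : 0 < (1 - κ ^ 2) + (κ - ρ) ^ 2 :=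
    pos_of_mul_pos_right (hcs ▸ pow_pos hc 2) (by positivity)
  have hκ : κ ^ 2 ≤ 1 := by
    have h := abs_real_inner_le_norm (y - x) (d - x)
    rw [hk, abs_mul, abs_of_pos (mul_pos ha hb)] at h
    have : |κ| ≤ 1 := le_of_mul_le_mul_right (by linarith) (mul_pos ha hb)
    exact (sq_le_one_iff_abs_le_one κ).2 this
  have hcn : ‖d - y‖ = ‖d - x‖ * √((1 - κ ^ 2) + (κ - ρ) ^ 2) := by
    rw [← Real.sqrt_sq hc.le, hcs, Real.sqrt_mul (by positivity), Real.sqrt_sq hb.le]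
  have hsq : 0 < √((1 - κ ^ 2) + (κ - ρ) ^ 2) := Real.sqrt_pos.2 hpos
  have hmain : dirCos (y - x) (d - y) = (κ - ρ) / √((1 - κ ^ 2) + (κ - ρ) ^ 2) := by
    rw [dirCos_eq_div, hin, hcn]
    field_simp
  rw [hmain, cosTorus]
  split_ifs with h
  · change Real.sign (κ - ρ) = _
    have h' : κ ^ 2 = 1 := h
    rw [h', sub_self, zero_add] at hpos ⊢
    rw [Real.sqrt_sq_eq_abs]
    rcases lt_trichotomy (κ - ρ) 0 with h0 | h0 | h0
    · rw [Real.sign_of_neg h0, abs_of_neg h0, div_neg, div_self h0.ne]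
    · rw [h0] at hpos; norm_num at hpos
    · rw [Real.sign_of_pos h0, abs_of_pos h0, div_self h0.ne']
  · exact cos_arccot_div_sqrt (sub_pos.2 (lt_of_le_of_ne hκ h))

lemma scatterPsi_eq {y x d s : E3} (hyx : y ≠ x) (hdx : d ≠ x) (hdy : d ≠ y) :
    scatterPsi y x d s = dirCos (y - x) (x - s) + dirCos (y - x) (d - y) := by
  rw [scatterPsi, cosTorus_eq_dirCos hyx hdx hdy, conePsi_eq_dirCos]

/-! ### Smoothness of `Ψ` on nondegenerate paths -/

/-- The configurations `(d, x, y)` for which the path `s → x → y → d` is nondegenerate. -/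
def pathDomain (s : E3) : Set (E3 × E3 × E3) :=
  {q | q.2.1 ≠ s ∧ q.2.2 ≠ q.2.1 ∧ q.1 ≠ q.2.1 ∧ q.1 ≠ q.2.2}

lemma isOpen_pathDomain (s : E3) : IsOpen (pathDomain s) := by
  refine (isOpen_ne_fun (by fun_prop) (by fun_prop)).inter
    ((isOpen_ne_fun (by fun_prop) (by fun_prop)).inter
    ((isOpen_ne_fun (by fun_prop) (by fun_prop)).inter
      (isOpen_ne_fun (by fun_prop) (by fun_prop))))

lemma contDiffAt_conePsi {s : E3} {q : E3 × E3 × E3} (hq : q ∈ pathDomain s) :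
    ContDiffAt ℝ ∞ (fun q : E3 × E3 × E3 => conePsi q.2.2 q.2.1 s) q :=
  contDiffAt_dirCos (f := fun q : E3 × E3 × E3 => q.2.2 - q.2.1) (g := fun q => q.2.1 - s)
    (by fun_prop) (by fun_prop) (sub_ne_zero.2 hq.2.1) (sub_ne_zero.2 hq.1)

lemma contDiffAt_cosTorus {s : E3} {q : E3 × E3 × E3} (hq : q ∈ pathDomain s) :
    ContDiffAt ℝ ∞ (fun q : E3 × E3 × E3 => cosTorus q.2.2 q.1 q.2.1) q := by
  refine (contDiffAt_dirCos (f := fun q : E3 × E3 × E3 => q.2.2 - q.2.1)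
    (g := fun q => q.1 - q.2.2) (by fun_prop) (by fun_prop) (sub_ne_zero.2 hq.2.1)
    (sub_ne_zero.2 hq.2.2.2)).congr_of_eventuallyEq ?_
  filter_upwards [(isOpen_pathDomain s).mem_nhds hq] with p hp
  exact cosTorus_eq_dirCos hp.2.1 hp.2.2.1 hp.2.2.2

lemma contDiffAt_scatterPsi {s : E3} {q : E3 × E3 × E3} (hq : q ∈ pathDomain s) :
    ContDiffAt ℝ ∞ (fun q : E3 × E3 × E3 => scatterPsi q.2.2 q.2.1 q.1 s) q :=
  (contDiffAt_conePsi hq).add (contDiffAt_cosTorus hq)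

/-- The upper bound on the cosines keeps the denominator in the Compton formula positive, and hence
the photon energies. -/
lemma conePsi_le_one (y x s : E3) : conePsi y x s ≤ 1 := dirCos_le_one _ _

lemma cosTorus_le_one {y d x : E3} (hyx : y ≠ x) (hdx : d ≠ x) (hdy : d ≠ y) :
    cosTorus y d x ≤ 1 := cosTorus_eq_dirCos hyx hdx hdy ▸ dirCos_le_one _ _

/-! ### Critical points of `Ψ` -/

/-- Moving the tip of `v` by a multiple of `w` turns the cosine of the angle with `w` at the rate
`(1 - cos²) ‖w‖ / ‖v‖`. -/
lemma hasDerivAt_dirCos_line {w v : E3} (hw : w ≠ 0) (hv : v ≠ 0) :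
    HasDerivAt (fun t : ℝ => dirCos w (v + t • w)) ((1 - dirCos w v ^ 2) * ‖w‖ / ‖v‖) 0 := by
  have hw' : 0 < ‖w‖ := norm_pos_iff.2 hw
  have hv' : 0 < ‖v‖ := norm_pos_iff.2 hv
  have hline : HasDerivAt (fun t : ℝ => v + t • w) w 0 := by
    simpa using ((hasDerivAt_id (0 : ℝ)).smul_const w).const_add v
  have hsq := hline.norm_sq
  have hn : HasDerivAt (fun t : ℝ => ‖v + t • w‖) (2 * inner ℝ v w / (2 * ‖v‖)) 0 := by
    have := hsq.sqrt (by simpa using hv)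
    simpa [Real.sqrt_sq] using this
  have hi : HasDerivAt (fun t : ℝ => inner ℝ w (v + t • w)) (inner ℝ w w) 0 := by
    simpa using (hasDerivAt_const (0 : ℝ) w).inner ℝ hline
  have hd := hi.div (hn.const_mul ‖w‖) (by simp [hw, hv])
  simp only [dirCos_eq_div]
  refine hd.congr_deriv ?_
  simp only [zero_smul, add_zero, real_inner_self_eq_norm_sq, real_inner_comm w v]
  field_simp

lemma dirCos_smul_left {c : ℝ} (hc : 0 < c) (u v : E3) : dirCos (c • u) v = dirCos u v := by
  simp only [dirCos_eq_div, real_inner_smul_left, norm_smul, Real.norm_of_nonneg hc.le]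
  rw [mul_assoc, mul_div_mul_left _ _ hc.ne']

lemma eventually_one_add_pos (c : ℝ) : ∀ᶠ t : ℝ in 𝓝 0, 0 < 1 + t * c :=
  (by fun_prop : Continuous fun t : ℝ => 1 + t * c).tendsto' 0 1 (by simp) |>.eventually
    (lt_mem_nhds one_pos)

/-- Moving `x` along `y - x` changes only the first scattering angle. -/
lemma hasDerivAt_scatterPsi_fst {s : E3} {d x y : E3} (hq : (d, x, y) ∈ pathDomain s) :
    HasDerivAt (fun t : ℝ => scatterPsi y (x + t • (y - x)) d s)
      ((1 - conePsi y x s ^ 2) * ‖y - x‖ / ‖x - s‖) 0 := by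
  have h1 := (hasDerivAt_dirCos_line (sub_ne_zero.2 hq.2.1) (sub_ne_zero.2 hq.1)).add_const
    (dirCos (y - x) (d - y))
  refine h1.congr_of_eventuallyEq ?_
  have hc : ContinuousAt (fun t : ℝ => (d, x + t • (y - x), y)) 0 := by fun_prop
  have hm : ∀ᶠ t : ℝ in 𝓝 0, (d, x + t • (y - x), y) ∈ pathDomain s :=
    hc.eventually ((isOpen_pathDomain s).mem_nhds (by simpa using hq))
  filter_upwards [hm, eventually_one_add_pos (-1)] with t ht htp
  rw [scatterPsi_eq ht.2.1 ht.2.2.1 ht.2.2.2]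
  -- The segment from `x` to `y` is only rescaled, by `1 - t > 0`, so the angle at `y` is unchanged.
  have e1 : y - (x + t • (y - x)) = (1 + t * (-1)) • (y - x) := by module
  have e2 : x + t • (y - x) - s = x - s + t • (y - x) := by abel
  simp only [e1, e2, dirCos_smul_left htp]

/-- Moving `y` along `y - x` changes only the second scattering angle. -/
lemma hasDerivAt_scatterPsi_snd {s : E3} {d x y : E3} (hq : (d, x, y) ∈ pathDomain s) :
    HasDerivAt (fun t : ℝ => scatterPsi (y + t • (y - x)) x d s)
      (-((1 - cosTorus y d x ^ 2) * ‖y - x‖ / ‖d - y‖)) 0 := by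
  rw [cosTorus_eq_dirCos hq.2.1 hq.2.2.1 hq.2.2.2]
  have h0 := hasDerivAt_dirCos_line (sub_ne_zero.2 hq.2.1) (sub_ne_zero.2 hq.2.2.2)
  -- Moving `y` by `t • (y - x)` moves `d - y` by the opposite vector, hence the minus sign.
  have h0' : HasDerivAt (fun t : ℝ => dirCos (y - x) (d - y + (-t) • (y - x)))
      (-((1 - dirCos (y - x) (d - y) ^ 2) * ‖y - x‖ / ‖d - y‖)) 0 := by
    have := HasDerivAt.comp (0 : ℝ) (h₂ := fun t : ℝ => dirCos (y - x) (d - y + t • (y - x)))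
      (by simpa using h0) (hasDerivAt_neg (0 : ℝ))
    simpa [Function.comp_def] using this
  refine (h0'.const_add (dirCos (y - x) (x - s))).congr_of_eventuallyEq ?_
  have hc : ContinuousAt (fun t : ℝ => (d, x, y + t • (y - x))) 0 := by fun_prop
  have hm : ∀ᶠ t : ℝ in 𝓝 0, (d, x, y + t • (y - x)) ∈ pathDomain s :=
    hc.eventually ((isOpen_pathDomain s).mem_nhds (by simpa using hq))
  filter_upwards [hm, eventually_one_add_pos 1] with t ht htp
  rw [scatterPsi_eq ht.2.1 ht.2.2.1 ht.2.2.2]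
  have e1 : y + t • (y - x) - x = (1 + t * 1) • (y - x) := by module
  have e2 : d - (y + t • (y - x)) = d - y + (-t) • (y - x) := by module
  simp only [e1, e2, dirCos_smul_left htp]

/-- A critical point of `Ψ` in `x` and in `y` has both scattering angles in `{0, π}`. -/
lemma scatterPsi_notMem_Ioo_of_critical {s : E3} {d x y : E3} (hq : (d, x, y) ∈ pathDomain s)
    (hx : HasDerivAt (fun t : ℝ => scatterPsi y (x + t • (y - x)) d s) 0 0)
    (hy : HasDerivAt (fun t : ℝ => scatterPsi (y + t • (y - x)) x d s) 0 0) :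
    scatterPsi y x d s ∉ Ioo (0 : ℝ) 2 := by
  have h1 := (hasDerivAt_scatterPsi_fst hq).unique hx
  have h2 := (hasDerivAt_scatterPsi_snd hq).unique hy
  have n1 : ‖y - x‖ ≠ 0 := norm_ne_zero_iff.2 (sub_ne_zero.2 hq.2.1)
  have n2 : ‖x - s‖ ≠ 0 := norm_ne_zero_iff.2 (sub_ne_zero.2 hq.1)
  have n3 : ‖d - y‖ ≠ 0 := norm_ne_zero_iff.2 (sub_ne_zero.2 hq.2.2.2)
  simp only [neg_eq_zero, div_eq_zero_iff, mul_eq_zero, n1, n2, n3, or_false, sub_eq_zero] at h1 h2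
  have h1 := sq_eq_one_iff.1 h1.symm
  have h2 := sq_eq_one_iff.1 h2.symm
  rw [scatterPsi]
  rintro ⟨h3, h4⟩
  -- Both cosines are `±1`; their sum is `-2`, `0` or `2`.
  rcases h1 with h1 | h1 <;> rcases h2 with h2 | h2 <;> rw [h1, h2] at h3 h4 <;>
    linarith

/-! ### Smoothness of the attenuation factors -/

/-- Differentiation under the integral sign, iterated. The derivative takes values in `H →L[ℝ] E`,
so `E` varies in the induction. Properness of `H` makes a closed ball compact, which gives the
dominating constant. -/
lemma contDiff_nat_intervalIntegral_param {H : Type} [NormedAddCommGroup H] [NormedSpace ℝ H]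
    [ProperSpace H] (n : ℕ) {E : Type} [NormedAddCommGroup E] [NormedSpace ℝ E] {f : H → ℝ → E}
    (hf : ContDiff ℝ n (fun q : H × ℝ => f q.1 q.2)) (a b : ℝ) :
    ContDiff ℝ n (fun x => ∫ t in a..b, f x t) := by
  induction n generalizing E with
  | zero =>
    rw [Nat.cast_zero, contDiff_zero] at hf ⊢
    exact intervalIntegral.continuous_parametric_intervalIntegral_of_continuous' hf a b
  | succ n ih =>
    rw [Nat.cast_succ] at hf ⊢
    set g : H → ℝ → H →L[ℝ] E := fun x t =>
      (fderiv ℝ (fun q : H × ℝ => f q.1 q.2) (x, t)).comp (ContinuousLinearMap.inl ℝ H ℝ)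
    have hg : ContDiff ℝ n (fun q : H × ℝ => g q.1 q.2) :=
      (hf.fderiv_right le_rfl).clm_comp contDiff_const
    have hgc : Continuous (fun q : H × ℝ => g q.1 q.2) := hg.continuous
    have hfc : Continuous (fun q : H × ℝ => f q.1 q.2) := hf.continuous
    have hsec : ∀ x t, HasFDerivAt (fun x => f x t) (g x t) x := fun x t =>
      HasFDerivAt.comp (g := fun q : H × ℝ => f q.1 q.2) (f := fun x => (x, t)) x
        (hf.differentiable (by simp) (x, t)).hasFDerivAt (hasFDerivAt_prodMk_left x t)
    refine contDiff_succ_iff_hasFDerivAt.2 ⟨fun x => ∫ t in a..b, g x t, ih hg, fun x => ?_⟩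
    obtain ⟨B, hB⟩ := ((isCompact_closedBall x 1).prod isCompact_uIcc).exists_bound_of_continuousOn
      (hgc.continuousOn (s := Metric.closedBall x 1 ×ˢ uIcc a b))
    refine intervalIntegral.hasFDerivAt_integral_of_dominated_of_fderiv_le (bound := fun _ => B)
      (Metric.closedBall_mem_nhds x one_pos) (.of_forall fun y => ?_) ?_ ?_ ?_ ?_ ?_
    · exact (hfc.comp (by fun_prop : Continuous fun t : ℝ => (y, t))).aestronglyMeasurable
    · exact (hfc.comp (by fun_prop : Continuous fun t : ℝ => (x, t))).intervalIntegrable a b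
    · exact (hgc.comp (by fun_prop : Continuous fun t : ℝ => (x, t))).aestronglyMeasurable
    · exact .of_forall fun t ht y hy => hB (y, t) ⟨hy, uIoc_subset_uIcc ht⟩
    · exact intervalIntegrable_const
    · exact .of_forall fun t _ y _ => hsec y t

lemma contDiff_intervalIntegral_param {H : Type} [NormedAddCommGroup H] [NormedSpace ℝ H]
    [ProperSpace H] {E : Type} [NormedAddCommGroup E] [NormedSpace ℝ E] {f : H → ℝ → E}
    (hf : ContDiff ℝ ∞ (fun q : H × ℝ => f q.1 q.2)) (a b : ℝ) :
    ContDiff ℝ ∞ (fun x => ∫ t in a..b, f x t) :=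
  contDiff_infty.2 fun n => contDiff_nat_intervalIntegral_param n (contDiff_infty.1 hf n) a b

/-- The mean of a smooth function over a segment depends smoothly on the end points. -/
lemma contDiff_segmentMean {g : E3 → ℝ} (hg : ContDiff ℝ ∞ g) :
    ContDiff ℝ ∞ (fun q : E3 × E3 => ∫ t in (0 : ℝ)..1, g (q.1 + t • (q.2 - q.1))) :=
  contDiff_intervalIntegral_param (hg.comp (by fun_prop)) 0 1

lemma contDiffAt_crossSection (C : PhysicalConstants) {E : ℝ} (hE : 0 < E) :
    ContDiffAt ℝ ∞ (crossSection C) E := by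
  have hmc := C.mc2_pos
  have hk : ContDiffAt ℝ ∞ (fun E : ℝ => E / C.mc2) E := contDiffAt_id.div_const _
  have hk0 : 0 < E / C.mc2 := div_pos hE hmc
  have hl : ContDiffAt ℝ ∞ (fun E : ℝ => Real.log (1 + 2 * (E / C.mc2))) E :=
    (contDiffAt_const.add (contDiffAt_const.mul hk)).log (by positivity)
  have h2 : ContDiffAt ℝ ∞ (fun E : ℝ => 1 + 2 * (E / C.mc2)) E :=
    contDiffAt_const.add (contDiffAt_const.mul hk)
  unfold crossSection
  refine contDiffAt_const.mul (((((contDiffAt_const.add hk).div (hk.pow 2) (by positivity)).mul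
    (((contDiffAt_const.mul (contDiffAt_const.add hk)).div h2 (by positivity)).sub
      (hl.div hk (by positivity)))).add (hl.div (contDiffAt_const.mul hk) (by positivity))).sub
      ((contDiffAt_const.add (contDiffAt_const.mul hk)).div (h2.pow 2) (by positivity)))

lemma comptonEnergy_pos (C : PhysicalConstants) {E c : ℝ} (hE : 0 < E) (hc : c ≤ 1) :
    0 < comptonEnergy C E c := by
  have hmc := C.mc2_pos
  have : 0 ≤ 1 - c := by linarith
  unfold comptonEnergy
  positivity

section

variable {V : Type*} [NormedAddCommGroup V] [NormedSpace ℝ V] {z : V}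

lemma contDiffAt_comptonEnergy (C : PhysicalConstants) {e c : V → ℝ} (he : ContDiffAt ℝ ∞ e z)
    (hc : ContDiffAt ℝ ∞ c z) (he0 : 0 < e z) (hc1 : c z ≤ 1) :
    ContDiffAt ℝ ∞ (fun z => comptonEnergy C (e z) (c z)) z := by
  have hmc := C.mc2_pos
  have : 0 ≤ 1 - c z := by linarith
  exact he.div (contDiffAt_const.add ((he.div_const _).mul (contDiffAt_const.sub hc)))
    (by positivity)

/-- The energy enters the attenuation only through scalar coefficients, so the line integral splits
into segment means of `lamPE` and `nE`, smooth everywhere, times functions of the energy that are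
smooth only for positive energy. -/
lemma contDiffAt_pathFactor (C : PhysicalConstants) {lamPE nE : E3 → ℝ}
    (hPE : ContDiff ℝ ∞ lamPE) (hnE : ContDiff ℝ ∞ nE) {e : V → ℝ} {m n : V → E3}
    (he : ContDiffAt ℝ ∞ e z) (he0 : 0 < e z) (hm : ContDiffAt ℝ ∞ m z) (hn : ContDiffAt ℝ ∞ n z)
    (hmn : n z ≠ m z) :
    ContDiffAt ℝ ∞ (fun z => pathFactor C lamPE nE (e z) (m z) (n z)) z := by
  have hint : ∀ {g : E3 → ℝ}, ContDiff ℝ ∞ g → ∀ (m n : E3),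
      IntervalIntegrable (fun t : ℝ => g (m + t • (n - m))) volume 0 1 := fun hg m n =>
    (hg.continuous.comp (by fun_prop)).intervalIntegrable 0 1
  have hatt : ∀ (E : ℝ) (m n : E3),
      ∫ t in (0 : ℝ)..1, attenuation C lamPE nE E (m + t • (n - m)) =
      (E ^ 3)⁻¹ * (∫ t in (0 : ℝ)..1, lamPE (m + t • (n - m))) +
        crossSection C E * ∫ t in (0 : ℝ)..1, nE (m + t • (n - m)) := fun E m n => by
    unfold attenuation
    rw [intervalIntegral.integral_add ((hint hPE m n).const_mul _) ((hint hnE m n).const_mul _),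
      intervalIntegral.integral_const_mul, intervalIntegral.integral_const_mul]
  have hmean : ∀ {g : E3 → ℝ}, ContDiff ℝ ∞ g →
      ContDiffAt ℝ ∞ (fun z => ∫ t in (0 : ℝ)..1, g (m z + t • (n z - m z))) z := fun hg =>
    (contDiff_segmentMean hg).contDiffAt.comp z (hm.prodMk hn)
  have hnm : ContDiffAt ℝ ∞ (fun z => n z - m z) z := hn.sub hm
  have hne : n z - m z ≠ 0 := sub_ne_zero.2 hmn
  unfold pathFactor
  simp only [hatt]
  exact ((hnm.norm_sq ℝ).inv (by simpa using hne)).mul ((hnm.norm ℝ hne).mul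
    ((((he.pow 3).inv (by positivity)).mul (hmean hPE)).add
      (((contDiffAt_crossSection C he0).comp z he).mul (hmean hnE)))).neg.exp

end

lemma contDiffAt_weight2 (C : PhysicalConstants) {lamPE nE : E3 → ℝ}
    (hPE : ContDiff ℝ ∞ lamPE) (hnE : ContDiff ℝ ∞ nE) {s : E3} {q : E3 × E3 × E3}
    (hq : q ∈ pathDomain s) :
    ContDiffAt ℝ ∞ (fun q : E3 × E3 × E3 => weight2 C lamPE nE q.2.1 q.2.2 q.1 s) q := by
  have c1 := conePsi_le_one q.2.2 q.2.1 s
  have c2 := cosTorus_le_one hq.2.1 hq.2.2.1 hq.2.2.2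
  have p1 := comptonEnergy_pos C C.E₀_pos c1
  have p2 := comptonEnergy_pos C p1 c2
  have s1 := contDiffAt_comptonEnergy C (contDiffAt_const (c := C.E₀)) (contDiffAt_conePsi hq)
    C.E₀_pos c1
  have s2 := contDiffAt_comptonEnergy C s1 (contDiffAt_cosTorus hq) p1 c2
  have hd : ContDiffAt ℝ ∞ (fun q : E3 × E3 × E3 => q.1) q := by fun_prop
  have hx : ContDiffAt ℝ ∞ (fun q : E3 × E3 × E3 => q.2.1) q := by fun_prop
  have hy : ContDiffAt ℝ ∞ (fun q : E3 × E3 × E3 => q.2.2) q := by fun_prop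
  exact ((contDiffAt_pathFactor C hPE hnE contDiffAt_const C.E₀_pos contDiffAt_const hx hq.1).mul
    (contDiffAt_pathFactor C hPE hnE s1 p1 hx hy hq.2.1)).mul
    (contDiffAt_pathFactor C hPE hnE s2 p2 hy hd hq.2.2.2)

/-! ### Partial derivatives and the gradient of `Ψ` -/

section

variable {E F G K : Type*} [NormedAddCommGroup E] [NormedSpace ℝ E] [NormedAddCommGroup F]
  [NormedSpace ℝ F] [NormedAddCommGroup G] [NormedSpace ℝ G] [NormedAddCommGroup K]
  [NormedSpace ℝ K] {f : E × F × G → K} {f' : E × F × G →L[ℝ] K} {d : E} {x : F} {y : G}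

lemma HasFDerivAt.partial_snd (hf : HasFDerivAt f f' (d, x, y)) :
    HasFDerivAt (fun z => f (d, z)) (f'.comp (ContinuousLinearMap.inr ℝ E (F × G))) (x, y) :=
  HasFDerivAt.comp (f := fun z => (d, z)) (x, y) hf (hasFDerivAt_prodMk_right d (x, y))

lemma HasFDerivAt.partial_snd_fst (hf : HasFDerivAt f f' (d, x, y)) :
    HasFDerivAt (fun x' => f (d, x', y)) ((f'.comp (ContinuousLinearMap.inr ℝ E (F × G))).comp
      (ContinuousLinearMap.inl ℝ F G)) x :=
  HasFDerivAt.comp (g := fun z => f (d, z)) (f := fun x => (x, y)) x hf.partial_snd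
    (hasFDerivAt_prodMk_left x y)

lemma HasFDerivAt.partial_snd_snd (hf : HasFDerivAt f f' (d, x, y)) :
    HasFDerivAt (fun y' => f (d, x, y')) ((f'.comp (ContinuousLinearMap.inr ℝ E (F × G))).comp
      (ContinuousLinearMap.inr ℝ F G)) y :=
  HasFDerivAt.comp (g := fun z => f (d, z)) (f := fun y => (x, y)) y hf.partial_snd
    (hasFDerivAt_prodMk_right x y)

end

/-- `Ψ` as a function of the detector and the two scattering points. -/
noncomputable def jointPsi (s : E3) (q : E3 × E3 × E3) : ℝ := scatterPsi q.2.2 q.2.1 q.1 s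

lemma hasFDerivAt_jointPsi {s : E3} {q : E3 × E3 × E3} (hq : q ∈ pathDomain s) :
    HasFDerivAt (jointPsi s) (fderiv ℝ (jointPsi s) q) q :=
  ((contDiffAt_scatterPsi hq).differentiableAt (by simp)).hasFDerivAt

lemma hasFDerivAt_scatterPsi_fst {s d x y : E3} (hq : (d, x, y) ∈ pathDomain s) :
    HasFDerivAt (fun x' => scatterPsi y x' d s)
      (((fderiv ℝ (jointPsi s) (d, x, y)).comp (ContinuousLinearMap.inr ℝ E3 (E3 × E3))).comp
        (ContinuousLinearMap.inl ℝ E3 E3)) x :=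
  (hasFDerivAt_jointPsi hq).partial_snd_fst

lemma hasFDerivAt_scatterPsi_snd {s d x y : E3} (hq : (d, x, y) ∈ pathDomain s) :
    HasFDerivAt (fun y' => scatterPsi y' x d s)
      (((fderiv ℝ (jointPsi s) (d, x, y)).comp (ContinuousLinearMap.inr ℝ E3 (E3 × E3))).comp
        (ContinuousLinearMap.inr ℝ E3 E3)) y :=
  (hasFDerivAt_jointPsi hq).partial_snd_snd

/-- Both gradients are Riesz representatives of restrictions of the one smooth map `fderiv ℝ
(jointPsi s)`. The squares are kept because a squared norm is smooth even where the gradient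
vanishes. -/
lemma contDiffAt_sq_normGradPsi {s : E3} {q : E3 × E3 × E3} (hq : q ∈ pathDomain s) :
    ContDiffAt ℝ ∞ (fun q : E3 × E3 × E3 =>
      ‖gradient (fun x' : E3 => scatterPsi q.2.2 x' q.1 s) q.2.1‖ ^ 2
        + ‖gradient (fun y' : E3 => scatterPsi y' q.2.1 q.1 s) q.2.2‖ ^ 2) q := by
  have hD : ContDiffAt ℝ ∞ (fderiv ℝ (jointPsi s)) q :=
    (contDiffAt_scatterPsi hq).fderiv_right (by simp)
  have hL : ∀ L : E3 →L[ℝ] E3 × E3, ContDiffAt ℝ ∞ (fun q : E3 × E3 × E3 =>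
      ‖(InnerProductSpace.toDual ℝ E3).symm (((fderiv ℝ (jointPsi s) q).comp
        (ContinuousLinearMap.inr ℝ E3 (E3 × E3))).comp L)‖ ^ 2) q :=
    fun L => ((InnerProductSpace.toDual ℝ E3).symm.contDiff.contDiffAt.comp q
      ((hD.clm_comp contDiffAt_const).clm_comp contDiffAt_const)).norm_sq ℝ
  refine ((hL (ContinuousLinearMap.inl ℝ E3 E3)).add
    (hL (ContinuousLinearMap.inr ℝ E3 E3))).congr_of_eventuallyEq ?_
  filter_upwards [(isOpen_pathDomain s).mem_nhds hq] with p hp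
  rw [(hasFDerivAt_scatterPsi_fst hp).hasGradientAt.gradient,
    (hasFDerivAt_scatterPsi_snd hp).hasGradientAt.gradient]

lemma hasDerivAt_line_of_hasFDerivAt_zero {E : Type*} [NormedAddCommGroup E] [NormedSpace ℝ E]
    {f : E → ℝ} {x : E} (hf : HasFDerivAt f (0 : E →L[ℝ] ℝ) x) (w : E) :
    HasDerivAt (fun t : ℝ => f (x + t • w)) 0 0 := by
  have hline : HasDerivAt (fun t : ℝ => x + t • w) w 0 := by
    simpa using ((hasDerivAt_id (0 : ℝ)).smul_const w).const_add x
  have hf' : HasFDerivAt f (0 : E →L[ℝ] ℝ) (x + (0 : ℝ) • w) := by simpa using hf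
  exact hf'.comp_hasDerivAt (0 : ℝ) hline

lemma sq_normGradPsi_ne_zero {s d x y : E3} (hq : (d, x, y) ∈ pathDomain s)
    (hΨ : scatterPsi y x d s ∈ Ioo (0 : ℝ) 2) :
    ‖gradient (fun x' : E3 => scatterPsi y x' d s) x‖ ^ 2
      + ‖gradient (fun y' : E3 => scatterPsi y' x d s) y‖ ^ 2 ≠ 0 := by
  intro h
  obtain ⟨h1, h2⟩ := (add_eq_zero_iff_of_nonneg (sq_nonneg _) (sq_nonneg _)).1 h
  rw [sq_eq_zero_iff, norm_eq_zero] at h1 h2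
  have g1 := (hasFDerivAt_scatterPsi_fst hq).differentiableAt.hasGradientAt.hasFDerivAt
  have g2 := (hasFDerivAt_scatterPsi_snd hq).differentiableAt.hasGradientAt.hasFDerivAt
  rw [h1, map_zero] at g1
  rw [h2, map_zero] at g2
  exact scatterPsi_notMem_Ioo_of_critical hq (hasDerivAt_line_of_hasFDerivAt_zero g1 _)
    (hasDerivAt_line_of_hasFDerivAt_zero g2 _) hΨ

/-- The condition `Ψ ∈ (0, 2)` serves only to keep the radicand of `‖∇Ψ‖` away from zero. -/
lemma contDiffAt_scatterWeight (C : PhysicalConstants) {lamPE nE : E3 → ℝ}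
    (hPE : ContDiff ℝ ∞ lamPE) (hnE : ContDiff ℝ ∞ nE) {s : E3} {q : E3 × E3 × E3}
    (hq : q ∈ pathDomain s) (hΨ : scatterPsi q.2.2 q.2.1 q.1 s ∈ Ioo (0 : ℝ) 2) :
    ContDiffAt ℝ ∞ (fun q : E3 × E3 × E3 => scatterWeight C lamPE nE q.2.1 q.2.2 q.1 s) q :=
  ((contDiffAt_sq_normGradPsi hq).sqrt (sq_normGradPsi_ne_zero hq hΨ)).mul
    (contDiffAt_weight2 C hPE hnE hq)

/-- A vanishing derivative would vanish along `(y - x, 0)` and `(0, y - x)`, the two directions that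
separate the scattering angles. -/
lemma fderiv_scatterPsi_pair_ne_zero {s d : E3} {z : E3 × E3} (hq : (d, z) ∈ pathDomain s)
    (hΨ : scatterPsi z.2 z.1 d s ∈ Ioo (0 : ℝ) 2) :
    fderiv ℝ (fun z : E3 × E3 => scatterPsi z.2 z.1 d s) z ≠ 0 := by
  intro h
  obtain ⟨x, y⟩ := z
  have h0 := (hasFDerivAt_jointPsi hq).partial_snd.differentiableAt.hasFDerivAt
  unfold jointPsi at h0
  rw [h] at h0
  refine scatterPsi_notMem_Ioo_of_critical hq ?_ ?_ hΨ
  · simpa using hasDerivAt_line_of_hasFDerivAt_zero h0 (y - x, 0)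
  · simpa using hasDerivAt_line_of_hasFDerivAt_zero h0 (0, y - x)

/-! ### Amplitudes of order zero and level-set phases -/

section Generalities

variable {P X : Type*} [NormedAddCommGroup P] [NormedSpace ℝ P]
  [NormedAddCommGroup X] [NormedSpace ℝ X]

/-- A smooth function of `(p, θ, x)` is an amplitude of order zero. -/
lemma isAmplitude_zero_of_contDiffOn {Λ : Set ℝ} {Θ : Set P} {Ω : Set X} (hΛ : IsOpen Λ)
    (hΘ : IsOpen Θ) (hΩ : IsOpen Ω) {A : ℝ → P → X → ℂ}
    (hA : ContDiffOn ℝ ∞ (fun q : ℝ × P × X => A q.1 q.2.1 q.2.2) (Λ ×ˢ Θ ×ˢ Ω)) :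
    IsAmplitude 0 Λ Θ Ω (fun p θ x _ => A p θ x) where
  smooth := hA.comp (g := fun q : ℝ × P × X => A q.1 q.2.1 q.2.2)
    (f := fun q : ℝ × P × X × ℝ => (q.1, q.2.1, q.2.2.1)) (by fun_prop)
    fun q hq => ⟨hq.1, hq.2.1, hq.2.2.1⟩
  bound K hK hKs j k := by
    -- Without `σ`-derivatives the weight is `(1 + |σ|) ^ 0`; any `σ`-derivative is zero.
    rcases k with _ | k
    · have hc : ContinuousOn (iteratedFDeriv ℝ j fun q : ℝ × P × X => A q.1 q.2.1 q.2.2)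
          (Λ ×ˢ Θ ×ˢ Ω) := by
        have ho := hΛ.prod (hΘ.prod hΩ)
        refine (hA.continuousOn_iteratedFDerivWithin (m := j) (mod_cast le_top)
          ho.uniqueDiffOn).congr fun q hq => ?_
        exact (iteratedFDerivWithin_of_isOpen j ho hq).symm
      obtain ⟨C, hC⟩ := hK.exists_bound_of_continuousOn (hc.mono hKs)
      exact ⟨C, fun q hq σ => by simpa using hC q hq⟩
    · refine ⟨0, fun q _ σ => ?_⟩
      have h0 : ∀ q' : ℝ × P × X,
          iteratedDeriv (k + 1) (fun _ : ℝ => A q'.1 q'.2.1 q'.2.2) σ = 0 := fun q' => by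
        simp [iteratedDeriv_const]
      have h1 : iteratedFDeriv ℝ j (fun _ : ℝ × P × X => (0 : ℂ)) q = 0 := by
        simp
      simp only [h0, h1, norm_zero, zero_mul, le_refl]

/-- Two of the conditions are free, since `∂_p Φ = σ ≠ 0` and `∂_p ∂_σ Φ = 1`. In the object
condition `∂_σ Φ = 0` forces `φ x θ = p ∈ Λ`, so regularity is needed only on levels in `Λ`. -/
lemma isPhaseFunction_levelSet {Λ : Set ℝ} {Θ : Set P} {Ω : Set X} {φ : X → P → ℝ}
    (hφ : ∀ θ ∈ Θ, ∀ x ∈ Ω, ContDiffAt ℝ ∞ (fun q : P × X => φ q.2 q.1) (θ, x))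
    (hreg : ∀ θ ∈ Θ, ∀ x ∈ Ω, φ x θ ∈ Λ → fderiv ℝ (fun x' => φ x' θ) x ≠ 0) :
    IsPhaseFunction Λ Θ Ω (fun p θ x σ => σ * (p - φ x θ)) := by
  have hderiv : ∀ (p : ℝ) (θ : P) (x : X) (σ : ℝ),
      deriv (fun σ : ℝ => σ * (p - φ x θ)) σ = p - φ x θ := fun p θ x σ => by simp
  refine ⟨?_, ?_, ?_, ?_, ?_⟩
  · rintro ⟨p, θ, x, σ⟩ hq
    have : ContDiffAt ℝ ∞ (fun q : ℝ × P × X × ℝ => φ q.2.2.1 q.2.1) (p, θ, x, σ) :=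
      ContDiffAt.comp (g := fun q : P × X => φ q.2 q.1)
        (f := fun q : ℝ × P × X × ℝ => (q.2.1, q.2.2.1)) (p, θ, x, σ)
        (hφ θ hq.2.1 x hq.2.2.1) (by fun_prop)
    have h1 : ContDiffAt ℝ ∞ (fun q : ℝ × P × X × ℝ => q.2.2.2) (p, θ, x, σ) := by fun_prop
    have h2 : ContDiffAt ℝ ∞ (fun q : ℝ × P × X × ℝ => q.1) (p, θ, x, σ) := by fun_prop
    exact (h1.mul (h2.sub this)).contDiffWithinAt
  · intros; ring
  · intro p _ θ hθ x hx σ hσ h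
    have hdφ : DifferentiableAt ℝ (fun q : ℝ × P => φ x q.2) (p, θ) :=
      DifferentiableAt.comp (g := fun q : P × X => φ q.2 q.1) (f := fun q : ℝ × P => (q.2, x))
        (p, θ) ((hφ θ hθ x hx).differentiableAt (by simp)) (by fun_prop)
    have hd : DifferentiableAt ℝ (fun q : ℝ × P => σ * (q.1 - φ x q.2)) (p, θ) :=
      (differentiableAt_fst.sub hdφ).const_mul σ
    have h1 := hd.hasFDerivAt
    rw [(Prod.mk.inj h).1] at h1
    have h2 := h1.comp_hasDerivAt p ((hasDerivAt_id p).prodMk (hasDerivAt_const p θ))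
    have h3 : HasDerivAt (fun p' : ℝ => σ * (p' - φ x θ)) σ p := by
      simpa using ((hasDerivAt_id p).sub_const (φ x θ)).const_mul σ
    exact hσ (by simpa using h3.unique h2)
  · intro p hp θ hθ x hx σ hσ h
    obtain ⟨h1, h2⟩ := Prod.mk.inj h
    rw [hderiv, sub_eq_zero] at h2
    refine hreg θ hθ x hx (h2 ▸ hp) ?_
    have hdφ : DifferentiableAt ℝ (fun x' : X => φ x' θ) x :=
      DifferentiableAt.comp (g := fun q : P × X => φ q.2 q.1) (f := fun x' : X => (θ, x'))
        x ((hφ θ hθ x hx).differentiableAt (by simp)) (by fun_prop)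
    have h3 := ((hdφ.hasFDerivAt.const_sub p).const_mul σ).fderiv
    rw [h1] at h3
    simpa [hσ] using h3.symm
  · intro p _ θ hθ x hx σ _ _ h
    simp only [hderiv] at h
    have hdφ : DifferentiableAt ℝ (fun q : ℝ × P × X => φ q.2.2 q.2.1) (p, θ, x) :=
      DifferentiableAt.comp (g := fun q : P × X => φ q.2 q.1) (f := fun q : ℝ × P × X => q.2)
        (p, θ, x) ((hφ θ hθ x hx).differentiableAt (by simp)) (by fun_prop)
    have hd : DifferentiableAt ℝ (fun q : ℝ × P × X => q.1 - φ q.2.2 q.2.1) (p, θ, x) :=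
      differentiableAt_fst.sub hdφ
    have h1 := hd.hasFDerivAt
    rw [h] at h1
    have h2 := h1.comp_hasDerivAt p ((hasDerivAt_id p).prodMk (hasDerivAt_const p (θ, x)))
    have h3 : HasDerivAt (fun p' : ℝ => p' - φ x θ) 1 p := (hasDerivAt_id p).sub_const _
    exact one_ne_zero (h3.unique h2)

end Generalities

/-! ### Cutting off the critical values -/

/-- A smooth function on `(0, 2) × ℝ`, equal to one on the diagonal and supported in
`(0, 2) × (0, 2)`. -/
noncomputable def levelCutoff (p q : ℝ) : ℝ :=
  (⟨1 / 4, 1 / 2, by norm_num, by norm_num⟩ : ContDiffBump (0 : ℝ)) ((q - p) / (p * (2 - p) / 2))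

lemma levelCutoff_self (p : ℝ) : levelCutoff p p = 1 := by
  rw [levelCutoff, sub_self, zero_div]
  exact ContDiffBump.one_of_mem_closedBall _ (Metric.mem_closedBall_self (by norm_num))

lemma contDiffAt_levelCutoff {p q : ℝ} (hp : p ∈ Ioo (0 : ℝ) 2) :
    ContDiffAt ℝ ∞ (fun r : ℝ × ℝ => levelCutoff r.1 r.2) (p, q) := by
  have h1 : 0 < 2 - p := sub_pos.2 hp.2
  have h2 := hp.1
  refine (ContDiffBump.contDiff _).contDiffAt.comp (p, q) (ContDiffAt.div ?_ ?_ ?_)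
  · fun_prop
  · fun_prop
  · positivity

/-- The scale `p (2 - p) / 2` is at most the distance from `p` to `{0, 2}`. A point `q` outside `(0,
2)` thus has rescaled distance at least `1`, strictly beyond the outer radius `1/2`, and this
persists nearby. -/
lemma eventually_levelCutoff_eq_zero {p q : ℝ} (hp : p ∈ Ioo (0 : ℝ) 2) (hq : q ∉ Ioo (0 : ℝ) 2) :
    ∀ᶠ r : ℝ × ℝ in 𝓝 (p, q), levelCutoff r.1 r.2 = 0 := by
  have h1 : 0 < 2 - p := sub_pos.2 hp.2
  have h2 := hp.1
  have hc : ContinuousAt (fun r : ℝ × ℝ => |(r.2 - r.1) / (r.1 * (2 - r.1) / 2)|) (p, q) :=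
    (ContinuousAt.div (by fun_prop) (by fun_prop) (by positivity)).abs
  have hlt : (1 / 2 : ℝ) < |(q - p) / (p * (2 - p) / 2)| := by
    rw [abs_div, abs_of_pos (by positivity : 0 < p * (2 - p) / 2), lt_div_iff₀ (by positivity),
      lt_abs]
    rcases le_or_gt q 0 with h | h
    · right; nlinarith
    · left
      have : 2 ≤ q := not_lt.1 fun h' => hq ⟨h, h'⟩
      nlinarith
  filter_upwards [hc.eventually (lt_mem_nhds hlt)] with r hr
  refine ContDiffBump.zero_of_le_dist _ ?_
  rw [dist_zero_right, Real.norm_eq_abs]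
  exact hr.le

/-- Where `q z ∉ (0, 2)` the product is locally zero, whatever the regularity of `w` there. -/
lemma contDiffAt_levelCutoff_mul {V : Type*} [NormedAddCommGroup V] [NormedSpace ℝ V] {z : V}
    {p q w : V → ℝ} (hp : ContDiffAt ℝ ∞ p z) (hq : ContDiffAt ℝ ∞ q z)
    (hpz : p z ∈ Ioo (0 : ℝ) 2) (hw : q z ∈ Ioo (0 : ℝ) 2 → ContDiffAt ℝ ∞ w z) :
    ContDiffAt ℝ ∞ (fun z => levelCutoff (p z) (q z) * w z) z := by
  by_cases h : q z ∈ Ioo (0 : ℝ) 2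
  · exact (ContDiffAt.comp (g := fun r : ℝ × ℝ => levelCutoff r.1 r.2) z
      (contDiffAt_levelCutoff hpz) (hp.prodMk hq)).mul (hw h)
  · refine (contDiffAt_const (c := (0 : ℝ))).congr_of_eventuallyEq ?_
    filter_upwards [(hp.continuousAt.prodMk hq.continuousAt).eventually
      (eventually_levelCutoff_eq_zero hpz h)] with y hy
    exact (congrArg (· * w y) hy).trans (zero_mul _)

lemma mem_pathDomain_of_mem_Omega2 {Ω : Set E3} {s e : E3} {N : E3 → Set E3} {z : E3 × E3}
    (hs : s ∉ Ω) (he : e ∉ Ω) (hN : ∀ x ∈ Ω, N x ∈ 𝓝 x) (hz : z ∈ Omega2 Ω N) :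
    (e, z) ∈ pathDomain s :=
  ⟨ne_of_mem_of_not_mem hz.1 hs,
    fun h : z.2 = z.1 => hz.2.2 (h.symm ▸ mem_of_mem_nhds (hN z.1 hz.1)),
    (ne_of_mem_of_not_mem hz.1 he).symm, (ne_of_mem_of_not_mem hz.2.1 he).symm⟩

lemma contDiffAt_levelCutoff_mul_comp {V W : Type*} [NormedAddCommGroup V] [NormedSpace ℝ V]
    [NormedAddCommGroup W] [NormedSpace ℝ W] {z : V} {p : V → ℝ} {e : V → W} {Ψ w : W → ℝ}
    (hp : ContDiffAt ℝ ∞ p z) (he : ContDiffAt ℝ ∞ e z) (hΨ : ContDiffAt ℝ ∞ Ψ (e z))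
    (hpz : p z ∈ Ioo (0 : ℝ) 2) (hw : Ψ (e z) ∈ Ioo (0 : ℝ) 2 → ContDiffAt ℝ ∞ w (e z)) (c : ℝ) :
    ContDiffAt ℝ ∞ (fun z => ((c * (levelCutoff (p z) (Ψ (e z)) * w (e z)) : ℝ) : ℂ)) z :=
  Complex.ofRealCLM.contDiff.contDiffAt.comp z (contDiffAt_const.mul
    (contDiffAt_levelCutoff_mul hp (hΨ.comp z he) hpz fun h => (hw h).comp z he))

/-- `𝒲₂` as a function of the detector and the two scattering points. -/
noncomputable def jointWeight (C : PhysicalConstants) (lamPE nE : E3 → ℝ) (s : E3)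
    (q : E3 × E3 × E3) : ℝ := scatterWeight C lamPE nE q.2.1 q.2.2 q.1 s

/-- The amplitude of the second-order scattering operator. -/
noncomputable def scatterAmplitude (C : PhysicalConstants) (lamPE nE : E3 → ℝ) (s : E3)
    {P : Type*} (d : P → E3) (p : ℝ) (θ : P) (z : E3 × E3) : ℂ :=
  (((2 * Real.pi)⁻¹ * (levelCutoff p (jointPsi s (d θ, z)) *
    jointWeight C lamPE nE s (d θ, z)) : ℝ) : ℂ)

section

variable {P : Type*} [NormedAddCommGroup P] [NormedSpace ℝ P] {d : P → E3} {θ : P} {s : E3}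
  {z : E3 × E3}

lemma contDiffAt_scatterPsi_detector (hd : ContDiffAt ℝ ∞ d θ) (hz : (d θ, z) ∈ pathDomain s) :
    ContDiffAt ℝ ∞ (fun q : P × E3 × E3 => scatterPsi q.2.2 q.2.1 (d q.1) s) (θ, z) :=
  ContDiffAt.comp (g := jointPsi s) (f := fun q : P × E3 × E3 => (d q.1, q.2)) (θ, z)
    (contDiffAt_scatterPsi hz)
    ((ContDiffAt.comp (θ, z) (g := d) hd contDiffAt_fst).prodMk contDiffAt_snd)

lemma contDiffAt_scatterAmplitude (C : PhysicalConstants) {lamPE nE : E3 → ℝ}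
    (hPE : ContDiff ℝ ∞ lamPE) (hnE : ContDiff ℝ ∞ nE) {p : ℝ} (hp : p ∈ Ioo (0 : ℝ) 2)
    (hd : ContDiffAt ℝ ∞ d θ) (hz : (d θ, z) ∈ pathDomain s) :
    ContDiffAt ℝ ∞ (fun q : ℝ × P × E3 × E3 =>
      scatterAmplitude C lamPE nE s d q.1 q.2.1 q.2.2) (p, θ, z) := by
  have hdq : ContDiffAt ℝ ∞ (fun q : ℝ × P × E3 × E3 => (d q.2.1, q.2.2)) (p, θ, z) :=
    (ContDiffAt.comp (p, θ, z) (g := d) (f := fun q : ℝ × P × E3 × E3 => q.2.1) hd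
      (by fun_prop)).prodMk (by fun_prop)
  exact contDiffAt_levelCutoff_mul_comp (p := fun q : ℝ × P × E3 × E3 => q.1)
    (e := fun q : ℝ × P × E3 × E3 => (d q.2.1, q.2.2)) (Ψ := jointPsi s)
    (w := jointWeight C lamPE nE s) (by fun_prop) hdq (contDiffAt_scatterPsi hz) hp
    (fun h => contDiffAt_scatterWeight C hPE hnE hz h) _

end

/-! ### Fourier decay and inversion in one variable -/

open scoped FourierTransform in
lemma norm_fourier_le_of_bound {f : ℝ → ℂ} {K : Set ℝ} {M : ℝ} (hK : IsCompact K)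
    (h0 : ∀ p ∉ K, f p = 0) (hM : ∀ p, ‖f p‖ ≤ M) (w : ℝ) : ‖𝓕 f w‖ ≤ M * volume.real K := by
  rw [Real.fourier_real_eq_integral_exp_smul, ← setIntegral_eq_integral_of_forall_compl_eq_zero
    (s := K) fun p hp => by rw [h0 p hp, smul_zero]]
  refine norm_setIntegral_le_of_norm_le_const hK.measure_lt_top fun p _ => ?_
  rw [norm_smul, Complex.norm_exp_ofReal_mul_I, one_mul]
  exact hM p

lemma deriv_eq_zero_of_notMem {f : ℝ → ℂ} {K : Set ℝ} (hK : IsClosed K) (h0 : ∀ p ∉ K, f p = 0)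
    {p : ℝ} (hp : p ∉ K) : deriv f p = 0 := by
  have : f =ᶠ[𝓝 p] fun _ => 0 := by
    filter_upwards [hK.isOpen_compl.mem_nhds hp] with x hx using h0 x hx
  rw [this.deriv_eq, deriv_const]

open scoped FourierTransform in
/-- Quadratic decay of the Fourier transform of a compactly supported `C²` function. -/
lemma norm_fourier_le_inv_one_add_sq {f : ℝ → ℂ} (hf : ContDiff ℝ 2 f) {K : Set ℝ} {M : ℝ}
    (hK : IsCompact K) (h0 : ∀ p ∉ K, f p = 0) (hM : ∀ p, ‖f p‖ ≤ M)
    (hM2 : ∀ p, ‖deriv (deriv f) p‖ ≤ M) (w : ℝ) :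
    ‖𝓕 f w‖ ≤ 2 * M * volume.real K * (1 + (2 * Real.pi * w) ^ 2)⁻¹ := by
  have hf1 : ContDiff ℝ 1 (deriv f) := by
    rw [show (2 : WithTop ℕ∞) = 1 + 1 by norm_num] at hf
    exact (contDiff_succ_iff_deriv.1 hf).2.2
  have hf2 : Continuous (deriv (deriv f)) := hf1.continuous_deriv le_rfl
  have h1 : ∀ p ∉ K, deriv f p = 0 := fun p => deriv_eq_zero_of_notMem hK.isClosed h0
  have h2 : ∀ p ∉ K, deriv (deriv f) p = 0 := fun p => deriv_eq_zero_of_notMem hK.isClosed h1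
  have i0 : Integrable f := hf.continuous.integrable_of_hasCompactSupport (.intro hK h0)
  have i1 : Integrable (deriv f) := hf1.continuous.integrable_of_hasCompactSupport (.intro hK h1)
  have i2 : Integrable (deriv (deriv f)) :=
    hf2.integrable_of_hasCompactSupport (.intro hK h2)
  have e2 : 𝓕 (deriv (deriv f)) w = (2 * Real.pi * Complex.I * w) ^ 2 * 𝓕 f w := by
    rw [Real.fourier_deriv i1 (hf1.differentiable one_ne_zero) i2,
      Real.fourier_deriv i0 (hf.differentiable two_ne_zero) i1]
    simp only [smul_eq_mul]
    ring
  have b0 := norm_fourier_le_of_bound hK h0 hM w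
  have b2 := norm_fourier_le_of_bound hK h2 hM2 w
  have en : ‖(2 * Real.pi * Complex.I * w : ℂ) ^ 2‖ = (2 * Real.pi * w) ^ 2 := by
    have : (2 * Real.pi * Complex.I * w : ℂ) = ((2 * Real.pi * w : ℝ) : ℂ) * Complex.I := by
      push_cast; ring
    rw [this, norm_pow, norm_mul, Complex.norm_I, mul_one, Complex.norm_real, Real.norm_eq_abs,
      sq_abs]
  rw [e2, norm_mul, en] at b2
  -- The bounds for the transforms of `f` and of its second derivative add up to `(1 + (2πw)²) ‖𝓕 f
  -- w‖ ≤ 2 M |K|`.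
  rw [← div_eq_mul_inv, le_div_iff₀ (by positivity)]
  linarith

open scoped FourierTransform in
-- The kernel of `𝓕` is `exp(-2πipw)`, so `σ = -2πw`. The right side is kept as a function evaluated
-- at a multiple of `σ`, ready for a linear change of variables.
lemma integral_exp_mul_eq_fourier (f : ℝ → ℂ) (t σ : ℝ) :
    ∫ p : ℝ, Complex.exp (Complex.I * ((σ * (p - t) : ℝ) : ℂ)) * f p =
      (fun w : ℝ => Complex.exp ((2 * Real.pi * (w * t) : ℝ) * Complex.I) • 𝓕 f w)
        (-(2 * Real.pi)⁻¹ * σ) := by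
  simp only
  rw [Real.fourier_real_eq_integral_exp_smul, ← integral_smul]
  refine integral_congr_ae (.of_forall fun p => ?_)
  simp only [smul_eq_mul]
  rw [← mul_assoc, ← Complex.exp_add]
  congr 2
  push_cast
  have : (Real.pi : ℂ) ≠ 0 := mod_cast Real.pi_ne_zero
  field_simp
  ring

open scoped FourierTransform in
/-- Fourier inversion with the kernel `exp (i σ (p - t))`. -/
lemma integral_integral_exp_mul {f : ℝ → ℂ} (hf : Continuous f) (hfi : Integrable f)
    (hff : Integrable (𝓕 f)) (t : ℝ) :
    ∫ σ : ℝ, ∫ p : ℝ, Complex.exp (Complex.I * ((σ * (p - t) : ℝ) : ℂ)) * f p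
      = 2 * Real.pi * f t := by
  simp only [integral_exp_mul_eq_fourier]
  -- The Jacobian of this substitution is the factor `2π` of the result.
  have h2 := Measure.integral_comp_mul_left
    (fun w : ℝ => Complex.exp ((2 * Real.pi * (w * t) : ℝ) * Complex.I) • 𝓕 f w)
    (-(2 * Real.pi)⁻¹)
  have h3 : ∫ w : ℝ, Complex.exp ((2 * Real.pi * (w * t) : ℝ) * Complex.I) • 𝓕 f w = f t := by
    rw [← congrFun (hf.fourierInv_fourier_eq hfi hff) t, Real.fourierInv_eq']
    simp [mul_comm]
  rw [h2, h3, inv_neg, inv_inv, abs_neg, abs_of_pos Real.two_pi_pos, Complex.real_smul]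
  push_cast
  rfl

/-! ### Fourier inversion with parameters -/

lemma contDiffOn_deriv_param {Y : Type*} [NormedAddCommGroup Y] [NormedSpace ℝ Y] {V : Set Y}
    (hV : IsOpen V) {B : Y → ℝ → ℂ}
    (hB : ContDiffOn ℝ ∞ (fun q : Y × ℝ => B q.1 q.2) (V ×ˢ univ)) :
    ContDiffOn ℝ ∞ (fun q : Y × ℝ => deriv (B q.1) q.2) (V ×ˢ univ) := by
  have ho : IsOpen (V ×ˢ (univ : Set ℝ)) := hV.prod isOpen_univ
  refine ((hB.fderiv_of_isOpen (m := ∞) ho (by simp)).clm_apply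
    (contDiffOn_const (c := ((0 : Y), (1 : ℝ))))).congr fun q hq => ?_
  have h1 := ((hB.contDiffAt (ho.mem_nhds hq)).differentiableAt (by simp)).hasFDerivAt
  exact (HasFDerivAt.comp_hasDerivAt (f := fun p : ℝ => (q.1, p)) q.2 h1
    ((hasDerivAt_const q.2 q.1).prodMk (hasDerivAt_id q.2))).deriv

/-- Nothing is known about `g` off `S`, but there `h` is zero, so `g` may be replaced by its
indicator on `S`. -/
lemma aestronglyMeasurable_mul_of_eq_zero {Y : Type*} [TopologicalSpace Y] [MeasurableSpace Y]
    [OpensMeasurableSpace Y] [SecondCountableTopologyEither Y ℂ] {μ : Measure Y} {S : Set Y}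
    (hS : MeasurableSet S) {g h : Y → ℂ} (hg : ContinuousOn g S) (hh : AEStronglyMeasurable h μ)
    (h0 : ∀ y ∉ S, h y = 0) : AEStronglyMeasurable (fun y => g y * h y) μ := by
  have : (fun y => g y * h y) = fun y => S.indicator g y * h y := by
    ext y
    by_cases hy : y ∈ S
    · rw [indicator_of_mem hy]
    · rw [h0 y hy, mul_zero, mul_zero]
  rw [this]
  exact ((aestronglyMeasurable_indicator_iff hS).2 (hg.aestronglyMeasurable hS)).mul hh

lemma sq_two_pi_mul_inv (σ : ℝ) : (2 * Real.pi * (-(2 * Real.pi)⁻¹ * σ)) ^ 2 = σ ^ 2 := by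
  have := Real.pi_pos
  field_simp

section OscillatoryIntegral

variable {Y : Type*} [NormedAddCommGroup Y] [NormedSpace ℝ Y] [MeasureSpace Y] [BorelSpace Y]
  [SFinite (volume : Measure Y)]

open scoped FourierTransform in
/-- Fourier inversion in `p` with parameters `y`, integrated against `h`. -/
theorem oscillatoryIntegral_eq {V D : Set Y} {K : Set ℝ} (hV : IsOpen V) (hD : IsCompact D)
    (hDV : D ⊆ V) (hK : IsCompact K) {B : Y → ℝ → ℂ}
    (hB : ContDiffOn ℝ ∞ (fun q : Y × ℝ => B q.1 q.2) (V ×ˢ univ))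
    (hB0 : ∀ y ∈ V, ∀ p ∉ K, B y p = 0) {φ : Y → ℝ} (hφ : ContinuousOn φ D) {h : Y → ℂ}
    (hh : Integrable h) (h0 : ∀ y ∉ D, h y = 0) :
    (∀ σ : ℝ, Integrable (fun q : Y × ℝ =>
      Complex.exp (Complex.I * ((σ * (q.2 - φ q.1) : ℝ) : ℂ)) * B q.1 q.2 * h q.1)) ∧
    Integrable (fun σ : ℝ => ∫ q : Y × ℝ,
      Complex.exp (Complex.I * ((σ * (q.2 - φ q.1) : ℝ) : ℂ)) * B q.1 q.2 * h q.1) ∧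
    ∫ σ : ℝ, ∫ q : Y × ℝ,
      Complex.exp (Complex.I * ((σ * (q.2 - φ q.1) : ℝ) : ℂ)) * B q.1 q.2 * h q.1
      = 2 * Real.pi * ∫ y, B y (φ y) * h y ∧
    Integrable (fun y => B y (φ y) * h y) := by
  have hsm : ∀ y ∈ V, ContDiff ℝ ∞ (B y) := fun y hy => by
    rw [← contDiffOn_univ]
    exact hB.comp (f := fun p : ℝ => (y, p)) (by fun_prop) fun p _ => ⟨hy, mem_univ p⟩
  have hB2 := contDiffOn_deriv_param hV (B := fun y => deriv (B y)) (contDiffOn_deriv_param hV hB)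
  -- Compactness of `D ×ˢ K` makes the bounds on `B` and its second `p`-derivative uniform in `y`,
  -- hence also the Fourier decay.
  obtain ⟨M₁, hM₁⟩ := (hD.prod hK).exists_bound_of_continuousOn
    (hB.continuousOn.mono (prod_mono hDV (subset_univ K)))
  obtain ⟨M₂, hM₂⟩ := (hD.prod hK).exists_bound_of_continuousOn
    (hB2.continuousOn.mono (prod_mono hDV (subset_univ K)))
  obtain ⟨M, hM0, hM1, hM2⟩ : ∃ M : ℝ, 0 ≤ M ∧ (∀ y ∈ D, ∀ p, ‖B y p‖ ≤ M) ∧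
      ∀ y ∈ D, ∀ p, ‖deriv (deriv (B y)) p‖ ≤ M := by
    refine ⟨max 0 (max M₁ M₂), le_max_left _ _, fun y hy p => ?_, fun y hy p => ?_⟩
    · by_cases hp : p ∈ K
      · exact (hM₁ (y, p) ⟨hy, hp⟩).trans (by simp)
      · simp [hB0 y (hDV hy) p hp]
    · by_cases hp : p ∈ K
      · exact (hM₂ (y, p) ⟨hy, hp⟩).trans (by simp)
      · rw [deriv_eq_zero_of_notMem hK.isClosed (fun p hp =>
          deriv_eq_zero_of_notMem hK.isClosed (hB0 y (hDV hy)) hp) hp]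
        simp
  have hBi : ∀ y ∈ D, Integrable (B y) := fun y hy =>
    (hsm y (hDV hy)).continuous.integrable_of_hasCompactSupport (.intro hK (hB0 y (hDV hy)))
  have hdecay : ∀ y ∈ D, ∀ w, ‖𝓕 (B y) w‖ ≤
      2 * M * volume.real K * (1 + (2 * Real.pi * w) ^ 2)⁻¹ := fun y hy =>
    norm_fourier_le_inv_one_add_sq (contDiff_infty.1 (hsm y (hDV hy)) 2) hK
      (hB0 y (hDV hy)) (hM1 y hy) (hM2 y hy)
  set F : ℝ → Y → ℝ → ℂ := fun σ y p =>
    Complex.exp (Complex.I * ((σ * (p - φ y) : ℝ) : ℂ)) * B y p * h y with hF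
  have hcont : ContinuousOn (fun r : (Y × ℝ) × ℝ =>
      Complex.exp (Complex.I * ((r.1.2 * (r.2 - φ r.1.1) : ℝ) : ℂ)) * B r.1.1 r.2)
      ((D ×ˢ univ) ×ˢ univ) := by
    have hφ' : ContinuousOn (fun r : (Y × ℝ) × ℝ => φ r.1.1) ((D ×ˢ univ) ×ˢ univ) :=
      hφ.comp (by fun_prop) fun r hr => hr.1.1
    have hB' : ContinuousOn (fun r : (Y × ℝ) × ℝ => B r.1.1 r.2) ((D ×ˢ univ) ×ˢ univ) :=
      hB.continuousOn.comp (f := fun r : (Y × ℝ) × ℝ => (r.1.1, r.2)) (by fun_prop)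
        fun r hr => ⟨hDV hr.1.1, mem_univ _⟩
    have hexp : Continuous fun t : ℝ => Complex.exp (Complex.I * (t : ℂ)) := by
      have := Complex.continuous_ofReal
      fun_prop
    exact (hexp.comp_continuousOn (f := fun r : (Y × ℝ) × ℝ => r.1.2 * (r.2 - φ r.1.1))
      ((by fun_prop : Continuous fun r : (Y × ℝ) × ℝ => r.1.2).continuousOn.mul
        (continuousOn_snd.sub hφ'))).mul hB'
  have hFm : AEStronglyMeasurable (fun r : (Y × ℝ) × ℝ => F r.1.2 r.1.1 r.2) volume :=
    aestronglyMeasurable_mul_of_eq_zero ((hD.measurableSet.prod .univ).prod .univ) hcont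
      hh.1.comp_fst.comp_fst fun r hr => h0 _ fun hr' => hr ⟨⟨hr', mem_univ _⟩, mem_univ _⟩
  have hFi : ∀ σ : ℝ, Integrable (fun q : Y × ℝ => F σ q.1 q.2) := fun σ => by
    have hm : AEStronglyMeasurable (fun q : Y × ℝ => F σ q.1 q.2) volume :=
      aestronglyMeasurable_mul_of_eq_zero (hD.measurableSet.prod .univ)
        (hcont.comp (f := fun q : Y × ℝ => ((q.1, σ), q.2)) (by fun_prop)
          fun q hq => ⟨⟨hq.1, mem_univ _⟩, mem_univ _⟩)
        hh.1.comp_fst fun r hr => h0 _ fun hr' => hr ⟨hr', mem_univ _⟩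
    have hk : Integrable (K.indicator fun _ : ℝ => M) :=
      (integrable_indicator_iff hK.measurableSet).2 (integrableOn_const hK.measure_lt_top.ne)
    refine (hh.norm.mul_prod hk).mono' hm (.of_forall fun ⟨y, p⟩ => ?_)
    by_cases hy : y ∈ D
    · by_cases hp : p ∈ K
      · simp only [hF, norm_mul, mul_comm Complex.I, Complex.norm_exp_ofReal_mul_I, one_mul,
          indicator_of_mem hp]
        rw [mul_comm]
        gcongr
        exact hM1 y hy p
      · simp [hF, hB0 y (hDV hy) p hp, hp]
    · simp [hF, h0 y hy]
  -- Integrating in `p` first gives the majorant `‖h y‖ (1 + σ²)⁻¹` up to a constant. This yields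
  -- absolute convergence in `σ` and justifies exchanging `y` and `σ`.
  have hGi : Integrable (fun r : Y × ℝ => ∫ p, F r.2 r.1 p) := by
    refine ((hh.norm.mul_prod integrable_inv_one_add_sq).const_mul
      (2 * M * volume.real K)).mono' hFm.integral_prod_right' (.of_forall fun ⟨y, σ⟩ => ?_)
    simp only [hF]
    by_cases hy : y ∈ D
    · rw [integral_mul_const, integral_exp_mul_eq_fourier, norm_mul, norm_smul,
        Complex.norm_exp_ofReal_mul_I, one_mul]
      have := hdecay y hy (-(2 * Real.pi)⁻¹ * σ)
      rw [sq_two_pi_mul_inv] at this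
      calc _ ≤ 2 * M * volume.real K * (1 + σ ^ 2)⁻¹ * ‖h y‖ := by gcongr
        _ = _ := by ring
    · simp [h0 y hy]
  have hsplit : ∀ σ : ℝ, ∫ q : Y × ℝ, F σ q.1 q.2 = ∫ y, ∫ p, F σ y p := fun σ =>
    integral_prod _ (hFi σ)
  refine ⟨hFi, ?_, ?_, ?_⟩
  · change Integrable (fun σ : ℝ => ∫ q : Y × ℝ, F σ q.1 q.2)
    simp only [hsplit]
    exact hGi.integral_prod_right
  · change ∫ σ : ℝ, ∫ q : Y × ℝ, F σ q.1 q.2 = _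
    simp only [hsplit]
    rw [← integral_integral_swap (f := fun y σ => ∫ p, F σ y p) hGi, ← integral_const_mul]
    refine integral_congr_ae (.of_forall fun y => ?_)
    by_cases hy : y ∈ D
    · have hff : Integrable (𝓕 (B y)) := by
        have hc : Continuous (𝓕 (B y)) := VectorFourier.fourierIntegral_continuous
          Real.continuous_fourierChar (by fun_prop : Continuous fun p : ℝ × ℝ => innerₗ ℝ p.1 p.2)
          (hBi y hy)
        have hi : Integrable fun w : ℝ => (1 + (2 * Real.pi * w) ^ 2)⁻¹ :=
          integrable_inv_one_add_sq.comp_mul_left' Real.two_pi_pos.ne'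
        exact (hi.const_mul _).mono' hc.aestronglyMeasurable (.of_forall (hdecay y hy))
      simp only [hF, integral_mul_const]
      rw [integral_integral_exp_mul (hsm y (hDV hy)).continuous (hBi y hy) hff, mul_assoc]
    · simp [hF, h0 y hy]
  · have hc : ContinuousOn (fun y => B y (φ y)) D :=
      hB.continuousOn.comp (f := fun y => (y, φ y)) (continuousOn_id.prodMk hφ)
        fun y hy => ⟨hDV hy, mem_univ _⟩
    refine (hh.norm.const_mul M).mono'
      (aestronglyMeasurable_mul_of_eq_zero hD.measurableSet hc hh.1 h0) (.of_forall fun y => ?_)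
    rw [norm_mul]
    by_cases hy : y ∈ D
    · gcongr; exact hM1 y hy _
    · simp [h0 y hy]

end OscillatoryIntegral

/-! ### Operators whose amplitude does not depend on `σ` -/

/-- The reordering `((p, θ), x) ↦ ((θ, x), p)`. -/
def rotateEquiv (P X : Type*) [MeasurableSpace P] [MeasurableSpace X] :
    (ℝ × P) × X ≃ᵐ (P × X) × ℝ :=
  MeasurableEquiv.prodAssoc.trans MeasurableEquiv.prodComm

lemma measurePreserving_rotateEquiv (P X : Type*) [MeasureSpace P] [MeasureSpace X]
    [SFinite (volume : Measure P)] [SFinite (volume : Measure X)] :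
    MeasurePreserving (rotateEquiv P X) :=
  (Measure.measurePreserving_swap (μ := (volume : Measure ℝ))
    (ν := (volume : Measure (P × X)))).comp
    (measurePreserving_prodAssoc (volume : Measure ℝ) (volume : Measure P) (volume : Measure X))

section OrderZero

variable {P X : Type*} [NormedAddCommGroup P] [NormedSpace ℝ P] [MeasureSpace P] [BorelSpace P]
  [SFinite (volume : Measure P)]
  [IsFiniteMeasureOnCompacts (volume : Measure P)]
  [NormedAddCommGroup X] [NormedSpace ℝ X] [MeasureSpace X] [BorelSpace X]
  [SecondCountableTopology X] [SFinite (volume : Measure X)]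

/-- Oscillatory integrals whose amplitude does not depend on `σ`. -/
theorem oscIntegrand_inversion {Λ : Set ℝ} {Θ : Set P} {Ω : Set X} (hΛ : IsOpen Λ)
    (hΘ : IsOpen Θ) (hΩ : IsOpen Ω) {A : ℝ → P → X → ℂ}
    (hA : ContDiffOn ℝ ∞ (fun q : ℝ × P × X => A q.1 q.2.1 q.2.2) (Λ ×ˢ Θ ×ˢ Ω))
    {φ : X → P → ℝ} (hφ : ContinuousOn (fun q : P × X => φ q.2 q.1) (Θ ×ˢ Ω))
    {u : X → ℂ} {v : ℝ × P → ℂ} (hu : IsCompactlySupportedL1 Ω u)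
    (hv : IsTestFunction (Λ ×ˢ Θ) v) :
    (∀ σ : ℝ, Integrable (oscIntegrand φ (fun p θ x _ => A p θ x) u v σ)) ∧
    Integrable (fun σ : ℝ => ∫ q, oscIntegrand φ (fun p θ x _ => A p θ x) u v σ q) ∧
    ∫ σ : ℝ, ∫ q, oscIntegrand φ (fun p θ x _ => A p θ x) u v σ q = 2 * Real.pi *
      ∫ y : P × X, A (φ y.2 y.1) y.1 y.2 * v (φ y.2 y.1, y.1) * u y.2 ∧
    Integrable (fun y : P × X => A (φ y.2 y.1) y.1 y.2 * v (φ y.2 y.1, y.1) * u y.2) := by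
  obtain ⟨hui, huc, hus⟩ := hu
  obtain ⟨hvs, hvc, hvt⟩ := hv
  set K₁ : Set ℝ := Prod.fst '' tsupport v
  set K₂ : Set P := Prod.snd '' tsupport v
  have hK₁ : IsCompact K₁ := hvc.isCompact.image continuous_fst
  have hK₂ : IsCompact K₂ := hvc.isCompact.image continuous_snd
  have hK₂Θ : K₂ ⊆ Θ := by rintro _ ⟨q, hq, rfl⟩; exact (hvt hq).2
  have hv1 : ∀ (p : ℝ) (θ : P), p ∉ K₁ → v (p, θ) = 0 := fun p θ hp =>
    image_eq_zero_of_notMem_tsupport fun hq => hp ⟨_, hq, rfl⟩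
  have hv2 : ∀ (p : ℝ) (θ : P), θ ∉ K₂ → v (p, θ) = 0 := fun p θ hp =>
    image_eq_zero_of_notMem_tsupport fun hq => hp ⟨_, hq, rfl⟩
  -- Constant in `θ`, the function `u` need not be integrable on `P × X`; the indicator of `K₂`
  -- repairs this and is harmless, since `v` vanishes for `θ ∉ K₂`.
  set h : P × X → ℂ := fun y => K₂.indicator (fun _ => (1 : ℂ)) y.1 * u y.2 with hh
  have hhi : Integrable h :=
    ((integrable_indicator_iff hK₂.measurableSet).2
      (integrableOn_const hK₂.measure_lt_top.ne)).mul_prod hui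
  have hh0 : ∀ y ∉ K₂ ×ˢ tsupport u, h y = 0 := fun y hy => by
    simp only [mem_prod, not_and_or] at hy
    rcases hy with hy | hy
    · simp [hh, hy]
    · simp [hh, image_eq_zero_of_notMem_tsupport hy]
  set B : P × X → ℝ → ℂ := fun y p => A p y.1 y.2 * v (p, y.1) with hBdef
  have hBsm : ContDiffOn ℝ ∞ (fun q : (P × X) × ℝ => B q.1 q.2) ((univ ×ˢ Ω) ×ˢ univ) := by
    rintro ⟨⟨θ, x⟩, p⟩ hq
    refine ContDiffAt.contDiffWithinAt ?_
    -- `A` is smooth only over `Λ ×ˢ Θ`, but off the support of `v` the product is locally zero, so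
    -- `B` is smooth for all real `p`.
    by_cases hpt : (p, θ) ∈ tsupport v
    · have hA' : ContDiffAt ℝ ∞ (fun q : (P × X) × ℝ => A q.2 q.1.1 q.1.2) ((θ, x), p) :=
        ContDiffAt.comp (g := fun q : ℝ × P × X => A q.1 q.2.1 q.2.2)
          (f := fun q : (P × X) × ℝ => (q.2, q.1)) ((θ, x), p)
          (hA.contDiffAt ((hΛ.prod (hΘ.prod hΩ)).mem_nhds
            ⟨(hvt hpt).1, (hvt hpt).2, hq.1.2⟩)) (by fun_prop)
      have hv' : ContDiffAt ℝ ∞ (fun q : (P × X) × ℝ => v (q.2, q.1.1)) ((θ, x), p) :=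
        (hvs.comp (f := fun q : (P × X) × ℝ => (q.2, q.1.1)) (by fun_prop)).contDiffAt
      exact hA'.mul hv'
    · refine (contDiffAt_const (c := (0 : ℂ))).congr_of_eventuallyEq ?_
      have hc : ContinuousAt (fun q : (P × X) × ℝ => (q.2, q.1.1)) ((θ, x), p) := by fun_prop
      filter_upwards [hc.eventually ((isClosed_tsupport v).isOpen_compl.mem_nhds hpt)] with q hq
      exact mul_eq_zero_of_right _ (image_eq_zero_of_notMem_tsupport hq)
  have hD : IsCompact (K₂ ×ˢ tsupport u) := hK₂.prod huc.isCompact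
  obtain ⟨r1, r2, r3, r4⟩ := oscillatoryIntegral_eq (K := K₁) (isOpen_univ.prod hΩ) hD
    (prod_mono (subset_univ _) hus) hK₁ hBsm
    (fun y _ p hp => mul_eq_zero_of_right _ (hv1 p y.1 hp))
    (hφ.mono (prod_mono hK₂Θ hus)) hhi hh0
  have hpt : ∀ (σ : ℝ) (q : (ℝ × P) × X), oscIntegrand φ (fun p θ x _ => A p θ x) u v σ q =
      (fun q : (P × X) × ℝ => Complex.exp (Complex.I * ((σ * (q.2 - φ q.1.2 q.1.1) : ℝ) : ℂ)) *
        B q.1 q.2 * h q.1) (rotateEquiv P X q) := by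
    rintro σ ⟨⟨p, θ⟩, x⟩
    change _ * A p θ x * u x * v (p, θ) =
      Complex.exp (Complex.I * ((σ * (p - φ x θ) : ℝ) : ℂ)) * (A p θ x * v (p, θ)) *
      (K₂.indicator (fun _ => (1 : ℂ)) θ * u x)
    by_cases hθ : θ ∈ K₂
    · rw [indicator_of_mem hθ]; ring
    · rw [hv2 p θ hθ]; ring
  have hint : ∀ σ : ℝ, ∫ q, oscIntegrand φ (fun p θ x _ => A p θ x) u v σ q =
      ∫ q : (P × X) × ℝ, Complex.exp (Complex.I * ((σ * (q.2 - φ q.1.2 q.1.1) : ℝ) : ℂ)) *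
        B q.1 q.2 * h q.1 := fun σ => by
    rw [funext (hpt σ)]
    exact (measurePreserving_rotateEquiv P X).integral_comp' (g := fun q : (P × X) × ℝ =>
      Complex.exp (Complex.I * ((σ * (q.2 - φ q.1.2 q.1.1) : ℝ) : ℂ)) * B q.1 q.2 * h q.1)
  have hgraph : (fun y : P × X => B y (φ y.2 y.1) * h y) =
      fun y => A (φ y.2 y.1) y.1 y.2 * v (φ y.2 y.1, y.1) * u y.2 := by
    ext y
    by_cases hθ : y.1 ∈ K₂
    · simp [hh, hBdef, hθ]
    · simp [hBdef, hv2 _ _ hθ]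
  refine ⟨fun σ => ?_, ?_, ?_, hgraph ▸ r4⟩
  · rw [show oscIntegrand φ (fun p θ x _ => A p θ x) u v σ = _ from funext (hpt σ)]
    exact ((measurePreserving_rotateEquiv P X).integrable_comp_emb
      (rotateEquiv P X).measurableEmbedding).2 (r1 σ)
  · simp only [hint]; exact r2
  · simp only [hint]
    rw [r3, hgraph]

end OrderZero

/-- A smooth amplitude `A` and a regular level-set function `φ` give a Fourier integral operator
whose pairing with test functions is `2π ∫ A u v` over the graph of `φ`. -/
theorem isFIOWith_of_levelSet {P X : Type*} [NormedAddCommGroup P] [NormedSpace ℝ P]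
    [MeasureSpace P] [BorelSpace P] [SFinite (volume : Measure P)]
    [IsFiniteMeasureOnCompacts (volume : Measure P)] [NormedAddCommGroup X] [NormedSpace ℝ X]
    [MeasureSpace X] [BorelSpace X] [SecondCountableTopology X] [SFinite (volume : Measure X)]
    {Λ : Set ℝ} {Θ : Set P} {Ω : Set X} (hΛ : IsOpen Λ) (hΘ : IsOpen Θ) (hΩ : IsOpen Ω)
    {A : ℝ → P → X → ℂ}
    (hA : ContDiffOn ℝ ∞ (fun q : ℝ × P × X => A q.1 q.2.1 q.2.2) (Λ ×ˢ Θ ×ˢ Ω))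
    {φ : X → P → ℝ}
    (hφ : ∀ θ ∈ Θ, ∀ x ∈ Ω, ContDiffAt ℝ ∞ (fun q : P × X => φ q.2 q.1) (θ, x))
    (hreg : ∀ θ ∈ Θ, ∀ x ∈ Ω, φ x θ ∈ Λ → fderiv ℝ (fun x' => φ x' θ) x ≠ 0)
    {T : (X → ℂ) → (ℝ × P → ℂ) → ℂ}
    (hT : ∀ u v, IsCompactlySupportedL1 Ω u → IsTestFunction (Λ ×ˢ Θ) v →
      T u v = 2 * Real.pi * ∫ y : P × X, A (φ y.2 y.1) y.1 y.2 * v (φ y.2 y.1, y.1) * u y.2)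
    {k : ℝ} (hk : k = -((Module.finrank ℝ X : ℝ) + (1 + (Module.finrank ℝ P : ℝ)) - 2) / 4) :
    IsFIOWith k Λ Θ Ω φ T := by
  refine ⟨hΛ, hΘ, hΩ, isPhaseFunction_levelSet hφ hreg, 0, fun p θ x _ => A p θ x,
    isAmplitude_zero_of_contDiffOn hΛ hΘ hΩ hA, by rw [hk]; ring, fun u v hu hv => ?_⟩
  obtain ⟨h1, h2, h3, -⟩ := oscIntegrand_inversion hΛ hΘ hΩ hA (φ := φ)
    (fun q hq => (hφ q.1 hq.1 q.2 hq.2).continuousAt.continuousWithinAt) hu hv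
  exact ⟨h1, h2, (hT u v hu hv).trans h3.symm⟩

/-! ### The second-order scattering operator -/

/-- On the graph `p = Ψ` the cutoff equals one, so it leaves no trace in the pairing; the factor
`(2π)⁻¹` cancels the one from Fourier inversion. -/
lemma scatterIntegrand_eq_amplitude (C : PhysicalConstants) (lamPE nE : E3 → ℝ) (s : E3)
    (d : EuclideanSpace ℝ (Fin 2) → E3) (F : E3 × E3 → ℂ)
    {v : ℝ × EuclideanSpace ℝ (Fin 2) → ℂ} (θ : EuclideanSpace ℝ (Fin 2)) (x y : E3) :
    scatterIntegrand C lamPE nE s d F v θ x y = 2 * Real.pi *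
      (scatterAmplitude C lamPE nE s d (scatterPsi y x (d θ) s) θ (x, y) *
        v (scatterPsi y x (d θ) s, θ) * F (x, y)) := by
  have hpi : (Real.pi : ℂ) ≠ 0 := mod_cast Real.pi_ne_zero
  rw [scatterIntegrand, scatterAmplitude]
  simp only [jointPsi, jointWeight, levelCutoff_self]
  push_cast
  field_simp

/-- The triple integral defining `ℒ₂` is an integral over the product space. -/
lemma scatterL2_eq_integral (C : PhysicalConstants) (lamPE nE : E3 → ℝ) (s : E3) (Ω : Set E3)
    (Θ : Set (EuclideanSpace ℝ (Fin 2))) (d : EuclideanSpace ℝ (Fin 2) → E3) {N : E3 → Set E3}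
    (hN : ∀ x ∈ Ω, N x ∈ 𝓝 x) {F : E3 × E3 → ℂ} {v : ℝ × EuclideanSpace ℝ (Fin 2) → ℂ}
    (hF : ∀ z ∉ Omega2 Ω N, F z = 0) (hv : ∀ p, ∀ θ ∉ Θ, v (p, θ) = 0)
    (hi : Integrable (fun q : EuclideanSpace ℝ (Fin 2) × (E3 × E3) =>
        scatterIntegrand C lamPE nE s d F v q.1 q.2.1 q.2.2)) :
    scatterL2 C lamPE nE s Ω Θ d F v = ∫ q : EuclideanSpace ℝ (Fin 2) × (E3 × E3),
      scatterIntegrand C lamPE nE s d F v q.1 q.2.1 q.2.2 := by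
  have hz : ∀ θ (x y : E3), (x, y) ∉ Omega2 Ω N →
      scatterIntegrand C lamPE nE s d F v θ x y = 0 := fun θ x y h => by
    simp [scatterIntegrand, hF _ h]
  rw [scatterL2, Measure.volume_eq_prod, integral_prod _ hi]
  rw [setIntegral_eq_integral_of_forall_compl_eq_zero fun θ hθ => by
    simp [scatterIntegrand, hv _ θ hθ]]
  refine integral_congr_ae ?_
  filter_upwards [Integrable.prod_right_ae hi] with θ hθ
  rw [setIntegral_eq_integral_of_forall_compl_eq_zero fun x hx => by
    simp [hz θ x _ fun h => hx h.1], Measure.volume_eq_prod, integral_prod _ hθ]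
  refine integral_congr_ae (.of_forall fun x => ?_)
  -- Restoring `y = x` costs nothing: `N x` contains `x`, so the diagonal misses `Omega2 Ω N` and
  -- `F` vanishes on it.
  refine setIntegral_eq_integral_of_forall_compl_eq_zero fun y hy => hz θ x y fun h => hy
    ⟨h.2.1, fun hyx => h.2.2 ?_⟩
  rw [show y = x from hyx]
  exact mem_of_mem_nhds (hN x h.1)

theorem theorem3p5 (C : PhysicalConstants)
    (lamPE nE : E3 → ℝ) (hPE : ContDiff ℝ ∞ lamPE) (hnE : ContDiff ℝ ∞ nE)
    (s : E3) (Ω : Set E3) (hΩ : IsOpen Ω) (hs : s ∉ Ω)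
    (Θ : Set (EuclideanSpace ℝ (Fin 2))) (hΘ : IsOpen Θ)
    (d : EuclideanSpace ℝ (Fin 2) → E3) (hd : ContDiffOn ℝ ∞ d Θ) (hdΩ : ∀ θ ∈ Θ, d θ ∉ Ω)
    (N : E3 → Set E3) (hN : ∀ x ∈ Ω, N x ∈ 𝓝 x) (hΩ₂ : IsOpen (Omega2 Ω N)) :
    (∀ (F : E3 × E3 → ℂ) (v : ℝ × EuclideanSpace ℝ (Fin 2) → ℂ),
      IsCompactlySupportedL1 (Omega2 Ω N) F → IsTestFunction (Ioo 0 2 ×ˢ Θ) v →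
      Integrable (fun q : EuclideanSpace ℝ (Fin 2) × (E3 × E3) =>
        scatterIntegrand C lamPE nE s d F v q.1 q.2.1 q.2.2)) ∧
    IsFIOWith (-7 / 4) (Ioo 0 2) Θ (Omega2 Ω N) (fun z θ => scatterPsi z.2 z.1 (d θ) s)
      (scatterL2 C lamPE nE s Ω Θ d) ∧
    scatterL2 C lamPE nE s Ω Θ d ∈ FIOClass (-7 / 4) (Ioo 0 2) Θ (Omega2 Ω N) := by
  have hdom : ∀ θ ∈ Θ, ∀ z ∈ Omega2 Ω N, (d θ, z) ∈ pathDomain s := fun θ hθ z hz =>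
    mem_pathDomain_of_mem_Omega2 hs (hdΩ θ hθ) hN hz
  have hdat : ∀ θ ∈ Θ, ContDiffAt ℝ ∞ d θ := fun θ hθ => hd.contDiffAt (hΘ.mem_nhds hθ)
  have hΨ : ∀ θ ∈ Θ, ∀ z ∈ Omega2 Ω N, ContDiffAt ℝ ∞
      (fun q : EuclideanSpace ℝ (Fin 2) × (E3 × E3) => scatterPsi q.2.2 q.2.1 (d q.1) s) (θ, z) :=
    fun θ hθ z hz => contDiffAt_scatterPsi_detector (hdat θ hθ) (hdom θ hθ z hz)
  have hA : ContDiffOn ℝ ∞ (fun q : ℝ × EuclideanSpace ℝ (Fin 2) × (E3 × E3) =>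
      scatterAmplitude C lamPE nE s d q.1 q.2.1 q.2.2) (Ioo 0 2 ×ˢ Θ ×ˢ Omega2 Ω N) := by
    rintro ⟨p, θ, z⟩ ⟨hp, hθ, hz⟩
    exact (contDiffAt_scatterAmplitude C hPE hnE hp (hdat θ hθ) (hdom θ hθ z hz)).contDiffWithinAt
  have hint : ∀ (F : E3 × E3 → ℂ) (v : ℝ × EuclideanSpace ℝ (Fin 2) → ℂ),
      IsCompactlySupportedL1 (Omega2 Ω N) F → IsTestFunction (Ioo 0 2 ×ˢ Θ) v →
      Integrable (fun q : EuclideanSpace ℝ (Fin 2) × (E3 × E3) =>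
        scatterIntegrand C lamPE nE s d F v q.1 q.2.1 q.2.2) := fun F v hF hv => by
    have hcont : ContinuousOn (fun q : EuclideanSpace ℝ (Fin 2) × (E3 × E3) =>
        scatterPsi q.2.2 q.2.1 (d q.1) s) (Θ ×ˢ Omega2 Ω N) := fun q hq =>
      (hΨ q.1 hq.1 q.2 hq.2).continuousAt.continuousWithinAt
    have h := (oscIntegrand_inversion isOpen_Ioo hΘ hΩ₂ hA
      (φ := fun z θ => scatterPsi z.2 z.1 (d θ) s) hcont hF hv).2.2.2
    simp only [scatterIntegrand_eq_amplitude]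
    exact h.const_mul (2 * (Real.pi : ℂ))
  have hFIO : IsFIOWith (-7 / 4) (Ioo 0 2) Θ (Omega2 Ω N)
      (fun z θ => scatterPsi z.2 z.1 (d θ) s) (scatterL2 C lamPE nE s Ω Θ d) := by
    have hreg : ∀ θ ∈ Θ, ∀ z ∈ Omega2 Ω N, scatterPsi z.2 z.1 (d θ) s ∈ Ioo (0 : ℝ) 2 →
        fderiv ℝ (fun z : E3 × E3 => scatterPsi z.2 z.1 (d θ) s) z ≠ 0 :=
      fun θ hθ z hz h => fderiv_scatterPsi_pair_ne_zero (hdom θ hθ z hz) h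
    have hk : (-7 / 4 : ℝ) = -((Module.finrank ℝ (E3 × E3) : ℝ) +
        (1 + (Module.finrank ℝ (EuclideanSpace ℝ (Fin 2)) : ℝ)) - 2) / 4 := by
      -- `6` object and `1 + 2` data dimensions: `(6 + 3 - 2) / 4 = 7 / 4`.
      rw [Module.finrank_prod, finrank_euclideanSpace_fin, finrank_euclideanSpace_fin]
      norm_num
    refine isFIOWith_of_levelSet isOpen_Ioo hΘ hΩ₂ hA
      (φ := fun z θ => scatterPsi z.2 z.1 (d θ) s) hΨ hreg (fun F v hF hv => ?_) hk
    rw [scatterL2_eq_integral C lamPE nE s Ω Θ d hN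
      (fun z hz => image_eq_zero_of_notMem_tsupport fun h => hz (hF.2.2 h))
      (fun p θ hθ => image_eq_zero_of_notMem_tsupport fun h => hθ (hv.2.2 h).2) (hint F v hF hv),
      ← integral_const_mul]
    simp only [scatterIntegrand_eq_amplitude]
  exact ⟨hint, hFIO, _, hFIO⟩
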